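/- Let $n\ge 3$ and let $a,b$ be real numbers with $a<n$, $b<n$. Let $\mathbf X=(\mathbf x_1,\dots,\mathbf x_n)$ be an i.i.d. sample from the bivariate normal distribution $N_2(\boldsymbol\mu,\boldsymbol\Sigma)$ with $$\boldsymbol\mu=\begin{pmatrix}\mu_1\\ \mu_2\end{pmatrix},\qquad \boldsymbol\Sigma=\begin{pmatrix}\sigma_1^2&\rho\sigma_1\sigma_2\\ \rho\sigma_1\sigma_2&\sigma_2^2\end{pmatrix},\qquad \sigma_1,\sigma_2>0,\ -1<\rho<1,$$ and let $\mathbf S=\sum_{k=1}^n(\mathbf x_k-\bar{\mathbf x})(\mathbf x_k-\bar{\mathbf x})'$, where $\bar{\mathbf x}=n^{-1}\sum_{k=1}^n\mathbf x_k$. Consider the prior density (with respect to $d\mu_1\,d\mu_2\,d\sigma_1\,d\sigma_2\,d\rho$) $$\pi_{ab}(\mu_1,\mu_2,\sigma_1,\sigma_2,\rho)=\frac{1}{\sigma_1^{3-a}\sigma_2^{2-b}(1-\rho^2)^{2-b/2}},$$ and let $\theta_3=|\boldsymbol\Sigma|=\sigma_1^2\sigma_2^2(1-\rho^2)$ be the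 generalized variance. Let $\chi^{2*}_{n-a},\chi^{2*}_{n-b}$ be independent chi-squared random variables with $n-a$ and $n-b$ degrees of freedom, and $\chi^2_{n-1},\chi^2_{n-2}$ independent chi-squared random variables with $n-1$ and $n-2$ degrees of freedom. A subscript $p$ on a random variable or distribution denotes its $p$-quantile. (a) For every data set $\mathbf X$ with $|\mathbf S|>0$, the posterior distribution of $(\mu_1,\mu_2,\sigma_1,\sigma_2,\rho)$ under $\pi_{ab}$ is proper, and the posterior distribution of $\theta_3$ given $\mathbf X$ is the distribution of $\theta_3^*=|\mathbf S|/(\chi^{2*}_{n-a}\chi^{2*}_{n-b})$ (with $|\mathbf S|$ held fixed). (b) Let $(\theta_3^*)_{1-\alpha}=(\theta_3^*)_{1-\alpha}(\mathbf X)$ be the $1-\alpha$ posterior quantile of $\theta_3$. For all $\mu_1,\mu_2\in\mathbb R$, $\sigma_1,\sigma_2>0$, $\rho\in(-1,1)$ and all $\alpha\in(0,1)$, the frequentist coverage of the one-sided credible interval $(0,(\theta_3^*)_{1-\alpha})$ is $$P\bigl(\theta_3<(\theta_3^*)_{1-\alpha}\mid \mu_1,\mu_2,\sigma_1,\sigma_2,\rho\bigr)=P\bigl(\chi^2_{n-1}\chi^2_{n-2}>(\chi^{2*}_{n-a}\chi^{2*}_{n-b})_{\alpha}\bigr),$$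 which does not depend on $\rho$ (nor on $\mu_1,\mu_2,\sigma_1,\sigma_2$). Furthermore, for any given $(\mu_1,\mu_2,\sigma_1,\sigma_2,\rho)$, this coverage equals $1-\alpha$ for every $\alpha\in(0,1)$ if and only if $(a,b)$ is $(1,2)$ or $(2,1)$. -/

import Mathlib

open MeasureTheory ProbabilityTheory

noncomputable section

namespace BivariateNormal

/-- A data set of `n` observations in the Euclidean plane; `x k i` is coordinate `i` of the
`k`-th observation. -/
abbrev Data (n : ℕ) := Fin n → EuclideanSpace ℝ (Fin 2)

/-- Sample mean vector. -/
def sampleMean {n : ℕ} (x : Data n) (i : Fin 2) : ℝ := (∑ k, x k i) / n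

/-- The scatter matrix `S = ∑ₖ (xₖ - x̄)(xₖ - x̄)'`. -/
def scatter {n : ℕ} (x : Data n) : Matrix (Fin 2) (Fin 2) ℝ :=
  Matrix.of fun i j => ∑ k, (x k i - sampleMean x i) * (x k j - sampleMean x j)

/-- The covariance matrix `Σ` with standard deviations `σ₁, σ₂` and correlation `ρ`. -/
def covMatrix (σ₁ σ₂ ρ : ℝ) : Matrix (Fin 2) (Fin 2) ℝ :=
  !![σ₁ ^ 2, ρ * σ₁ * σ₂; ρ * σ₁ * σ₂, σ₂ ^ 2]

/-- The generalized variance `θ₃ = |Σ|`. -/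
def genVar (σ₁ σ₂ ρ : ℝ) : ℝ := (covMatrix σ₁ σ₂ ρ).det

/-- The law of an i.i.d. sample of size `n` from `N₂((μ₁, μ₂)', Σ)`. -/
def samplingLaw (n : ℕ) (μ₁ μ₂ σ₁ σ₂ ρ : ℝ) : Measure (Data n) :=
  Measure.pi fun _ => multivariateGaussian !₂[μ₁, μ₂] (covMatrix σ₁ σ₂ ρ)

/-- The Lebesgue density of `N₂(m, V)` at `y`, for positive definite `V`. -/
def normalDensity (m : EuclideanSpace ℝ (Fin 2)) (V : Matrix (Fin 2) (Fin 2) ℝ)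
    (y : EuclideanSpace ℝ (Fin 2)) : ℝ :=
  (2 * Real.pi * √V.det)⁻¹ *
    Real.exp (-(1 / 2) * ((fun i => y i - m i) ⬝ᵥ (V⁻¹.mulVec fun i => y i - m i)))

/-- The likelihood of the parameters given the data `x`. -/
def likelihood {n : ℕ} (x : Data n) (μ₁ μ₂ σ₁ σ₂ ρ : ℝ) : ℝ :=
  ∏ k, normalDensity !₂[μ₁, μ₂] (covMatrix σ₁ σ₂ ρ) (x k)

/-- The prior density `π_ab`, with respect to `dμ₁ dμ₂ dσ₁ dσ₂ dρ`; it is constant in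
`(μ₁, μ₂)`. -/
def prior (a b : ℝ) (σ₁ σ₂ ρ : ℝ) : ℝ :=
  1 / (σ₁ ^ (3 - a) * σ₂ ^ (2 - b) * (1 - ρ ^ 2) ^ (2 - b / 2))

/-- The parameter space: all `(μ₁, μ₂, σ₁, σ₂, ρ)` with `σ₁, σ₂ > 0` and `-1 < ρ < 1`. -/
def paramSpace : Set (ℝ × ℝ × ℝ × ℝ × ℝ) :=
  {p | 0 < p.2.2.1 ∧ 0 < p.2.2.2.1 ∧ p.2.2.2.2 ∈ Set.Ioo (-1 : ℝ) 1}

/-- The measure with density prior times likelihood on the parameter space. -/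
def unnormalizedPosterior (a b : ℝ) {n : ℕ} (x : Data n) : Measure (ℝ × ℝ × ℝ × ℝ × ℝ) :=
  (volume.restrict paramSpace).withDensity fun p =>
    ENNReal.ofReal (prior a b p.2.2.1 p.2.2.2.1 p.2.2.2.2 *
      likelihood x p.1 p.2.1 p.2.2.1 p.2.2.2.1 p.2.2.2.2)

/-- The posterior distribution of `(μ₁, μ₂, σ₁, σ₂, ρ)` given the data `x`, under `π_ab`. It is a
probability measure exactly when the unnormalized posterior has finite nonzero total mass. -/
def posterior (a b : ℝ) {n : ℕ} (x : Data n) : Measure (ℝ × ℝ × ℝ × ℝ × ℝ) :=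
  (unnormalizedPosterior a b x Set.univ)⁻¹ • unnormalizedPosterior a b x

/-- The marginal posterior distribution of the generalized variance given the data `x`. -/
def posteriorGenVar (a b : ℝ) {n : ℕ} (x : Data n) : Measure ℝ :=
  (posterior a b x).map fun p => genVar p.2.2.1 p.2.2.2.1 p.2.2.2.2

/-- The chi-squared distribution with `k > 0` (real) degrees of freedom. -/
def chiSquared (k : ℝ) : Measure ℝ := gammaMeasure (k / 2) (1 / 2)

/-- The joint law of two independent chi-squared variables. -/
def chiSquaredPair (k l : ℝ) : Measure (ℝ × ℝ) := (chiSquared k).prod (chiSquared l)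

/-- The `p`-quantile of a probability distribution on the real line. -/
def quantile (ν : Measure ℝ) (p : ℝ) : ℝ := sInf {t | p ≤ ν.real (Set.Iic t)}

/-- The frequentist coverage, at the true parameters `(μ₁, μ₂, σ₁, σ₂, ρ)`, of the one-sided
credible interval for the generalized variance whose upper end point is the posterior
`1 - α` quantile under `π_ab`. -/
def coverage (n : ℕ) (a b α μ₁ μ₂ σ₁ σ₂ ρ : ℝ) : ℝ :=
  (samplingLaw n μ₁ μ₂ σ₁ σ₂ ρ).real
    {x | genVar σ₁ σ₂ ρ < quantile (posteriorGenVar a b x) (1 - α)}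

end BivariateNormal

end

/-!
The argument rests on one reparametrization and one decomposition, which produce the same kind of
law.

*Posterior.* With `τ = σ₂ √(1 - ρ²)` the residual standard deviation and `β = ρ σ₂ / σ₁` the slope
of the regression of the second coordinate on the first, the quadratic form of `Σ⁻¹` becomes
`y₁² / σ₁² + (y₂ - β y₁)² / τ²` (`normalDensity_covMatrix`), and the prior becomes
`σ₁ ^ (a - 2) τ ^ (b - 3) dσ₁ dτ dβ` (`prior_eq`, `lintegral_regression`). Completing squares, the
means and `β` integrate out as Gaussian integrals. What is left factors into a function of `σ₁` and
one of `τ`, which say that `S₁₁ / σ₁²` and `(|S| / S₁₁) / τ²` are independent chi-squared variables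
with `n - a` and `n - b` degrees of freedom (`exists_lintegral_eq_chiSquared`). Since
`|Σ| = σ₁² τ²`, the posterior of `|Σ|` is the law of `|S|` over their product
(`posterior_proper_and_genVar`).

*Sampling.* An affine map reduces the sample to a standard Gaussian one and multiplies `|S|` by
`|Σ|` (`scatter_affine`). For a standard sample `|S|` is the Gram determinant of the projections of
two independent standard Gaussian vectors of `ℝⁿ` to the hyperplane of centred vectors. It is the
squared length of the first one times the squared distance of the second one from the line it spans,
hence a product of independent chi-squared variables with `n - 1` and `n - 2` degrees of freedom
(`map_gram_stdGaussian`, `map_det_scatter_div_samplingLaw`).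

*Coverage.* The upper posterior quantile is `|S|` divided by the lower quantile of the product law
(`quantile_map_div`), which gives the coverage formula (`coverage_eq`). Every positive number is a
quantile of the product law, so exact coverage at all levels means that the two product laws agree
(`forall_tail_quantile_iff`), and their first two moments, `k l` and `k (k + 2) l (l + 2)`, determine
the unordered pair of degrees of freedom (`eq_or_eq_of_chiSquaredMul_eq`).
-/

open scoped ENNReal RealInnerProductSpace

noncomputable section

namespace BivariateNormal

/-! ### Chi-squared laws and their products -/

lemma isProbabilityMeasure_chiSquared {k : ℝ} (hk : 0 < k) :
    IsProbabilityMeasure (chiSquared k) :=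
  isProbabilityMeasure_gammaMeasure (by positivity) (by norm_num)

lemma isProbabilityMeasure_chiSquaredPair {k l : ℝ} (hk : 0 < k) (hl : 0 < l) :
    IsProbabilityMeasure (chiSquaredPair k l) := by
  have := isProbabilityMeasure_chiSquared hk
  have := isProbabilityMeasure_chiSquared hl
  unfold chiSquaredPair
  infer_instance

@[fun_prop]
lemma measurable_gammaPDF (a r : ℝ) : Measurable (gammaPDF a r) :=
  (measurable_gammaPDFReal a r).ennreal_ofReal

lemma chiSquared_absolutelyContinuous (k : ℝ) : chiSquared k ≪ volume :=
  withDensity_absolutelyContinuous _ _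

lemma chiSquared_pos_of_Ioo {k s t : ℝ} (hk : 0 < k) (hs : 0 ≤ s) (hst : s < t) :
    chiSquared k (Set.Ioo s t) ≠ 0 := by
  intro h
  rw [chiSquared, gammaMeasure, withDensity_apply _ measurableSet_Ioo,
    lintegral_eq_zero_iff (measurable_gammaPDF _ _),
    ae_restrict_eq measurableSet_Ioo] at h
  have h2 : ∀ᵐ z ∂(volume : Measure ℝ), z ∉ Set.Ioo s t := by
    filter_upwards [Filter.eventually_inf_principal.1 h] with z hz hzm
    have := gammaPDFReal_pos (a := k / 2) (r := 1 / 2) (by positivity) (by norm_num)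
      (hs.trans_lt hzm.1)
    have h3 := hz hzm
    simp only [gammaPDF, Pi.zero_apply, ENNReal.ofReal_eq_zero] at h3
    linarith
  have h3 : volume (Set.Ioo s t) = 0 := by
    rw [measure_eq_zero_iff_ae_notMem]; exact h2
  simp [Real.volume_Ioo] at h3
  linarith

lemma ae_pos_chiSquared (k : ℝ) : ∀ᵐ z ∂(chiSquared k), 0 < z := by
  have h0 : chiSquared k (Set.Iio 0) = 0 := by
    rw [chiSquared, gammaMeasure, withDensity_apply _ measurableSet_Iio]
    exact lintegral_gammaPDF_of_nonpos le_rfl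
  have h1 : chiSquared k {0} = 0 := chiSquared_absolutelyContinuous k (by simp)
  rw [ae_iff]
  refine measure_mono_null (t := Set.Iio 0 ∪ {0}) ?_ (measure_union_null h0 h1)
  intro z hz
  simp only [not_lt, Set.mem_ofPred_eq] at hz
  rcases hz.lt_or_eq with h | h
  · exact Or.inl h
  · exact Or.inr h

lemma ae_pos_chiSquaredPair {k l : ℝ} (hk : 0 < k) (hl : 0 < l) :
    ∀ᵐ z ∂(chiSquaredPair k l), 0 < z.1 ∧ 0 < z.2 := by
  have := isProbabilityMeasure_chiSquared hk
  have := isProbabilityMeasure_chiSquared hl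
  have h1 := (Measure.quasiMeasurePreserving_fst (μ := chiSquared k) (ν := chiSquared l)).ae
    (ae_pos_chiSquared k)
  have h2 := (Measure.quasiMeasurePreserving_snd (μ := chiSquared k) (ν := chiSquared l)).ae
    (ae_pos_chiSquared l)
  exact h1.and h2

/-- Multiplying the gamma density by `z` raises the shape parameter by one. -/
lemma gammaPDF_mul_ofReal {a r : ℝ} (ha : 0 < a) (hr : 0 < r) (z : ℝ) :
    gammaPDF a r z * ENNReal.ofReal z = ENNReal.ofReal (a / r) * gammaPDF (a + 1) r z := by
  rcases lt_or_ge z 0 with hz | hz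
  · rw [gammaPDF_of_neg hz, gammaPDF_of_neg hz]; simp
  · rw [gammaPDF_of_nonneg hz, gammaPDF_of_nonneg hz, ← ENNReal.ofReal_mul' hz,
      ← ENNReal.ofReal_mul (by positivity)]
    congr 1
    rcases hz.eq_or_lt with rfl | hz'
    · simp [Real.zero_rpow ha.ne']
    · have h1 := Real.Gamma_pos_of_pos ha
      rw [Real.Gamma_add_one ha.ne', Real.rpow_add hr, Real.rpow_one, add_sub_cancel_right,
        Real.rpow_sub hz', Real.rpow_one]
      field_simp

lemma lintegral_ofReal_mul_gammaPDF {a r : ℝ} (ha : 0 < a) (hr : 0 < r) :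
    ∫⁻ z, gammaPDF a r z * ENNReal.ofReal z = ENNReal.ofReal (a / r) := by
  simp_rw [gammaPDF_mul_ofReal ha hr]
  rw [lintegral_const_mul _ (measurable_gammaPDF _ _),
    lintegral_gammaPDF_eq_one (by positivity) hr, mul_one]

lemma lintegral_id_chiSquared {k : ℝ} (hk : 0 < k) :
    ∫⁻ z, ENNReal.ofReal z ∂(chiSquared k) = ENNReal.ofReal k := by
  rw [chiSquared, gammaMeasure, lintegral_withDensity_eq_lintegral_mul _ (measurable_gammaPDF _ _)
    ENNReal.measurable_ofReal]
  simp only [Pi.mul_apply]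
  rw [lintegral_ofReal_mul_gammaPDF (by positivity) (by norm_num)]
  congr 1; ring

lemma lintegral_sq_chiSquared {k : ℝ} (hk : 0 < k) :
    ∫⁻ z, ENNReal.ofReal z ^ 2 ∂(chiSquared k) = ENNReal.ofReal (k * (k + 2)) := by
  rw [chiSquared, gammaMeasure, lintegral_withDensity_eq_lintegral_mul _ (measurable_gammaPDF _ _)
    (ENNReal.measurable_ofReal.pow_const 2)]
  simp only [Pi.mul_apply, pow_two]
  simp_rw [← mul_assoc, gammaPDF_mul_ofReal (show 0 < k / 2 by positivity)
    (show (0 : ℝ) < 1 / 2 by norm_num), mul_assoc]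
  rw [lintegral_const_mul _ (by fun_prop),
    lintegral_ofReal_mul_gammaPDF (by positivity) (by norm_num),
    ← ENNReal.ofReal_mul (by positivity)]
  congr 1; ring

/-- The law of the product of two independent chi-squared variables. -/
def chiSquaredMul (k l : ℝ) : Measure ℝ := (chiSquaredPair k l).map fun z => z.1 * z.2

lemma isProbabilityMeasure_chiSquaredMul {k l : ℝ} (hk : 0 < k) (hl : 0 < l) :
    IsProbabilityMeasure (chiSquaredMul k l) := by
  have := isProbabilityMeasure_chiSquaredPair hk hl
  exact Measure.isProbabilityMeasure_map (by fun_prop)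

lemma chiSquaredMul_comm {k l : ℝ} (hk : 0 < k) (hl : 0 < l) :
    chiSquaredMul k l = chiSquaredMul l k := by
  have := isProbabilityMeasure_chiSquared hk
  have := isProbabilityMeasure_chiSquared hl
  rw [chiSquaredMul, chiSquaredMul, chiSquaredPair, chiSquaredPair,
    ← Measure.prod_swap (μ := chiSquared k), Measure.map_map (by fun_prop) (by fun_prop)]
  congr 1
  ext z
  simp [mul_comm]

lemma ae_pos_chiSquaredMul {k l : ℝ} (hk : 0 < k) (hl : 0 < l) :
    ∀ᵐ w ∂(chiSquaredMul k l), 0 < w := by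
  rw [chiSquaredMul, ae_map_iff (by fun_prop) measurableSet_Ioi]
  filter_upwards [ae_pos_chiSquaredPair hk hl] with z hz
  exact mul_pos hz.1 hz.2

lemma lintegral_chiSquaredMul {k l : ℝ} (hk : 0 < k) (hl : 0 < l) {f : ℝ → ℝ≥0∞}
    (hf : Measurable f) :
    ∫⁻ w, f w ∂(chiSquaredMul k l) =
      ∫⁻ z₁, ∫⁻ z₂, f (z₁ * z₂) ∂(chiSquared l) ∂(chiSquared k) := by
  have := isProbabilityMeasure_chiSquared hk
  have := isProbabilityMeasure_chiSquared hl
  rw [chiSquaredMul, lintegral_map hf (by fun_prop), chiSquaredPair,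
    lintegral_prod _ (by fun_prop)]

lemma chiSquaredMul_apply {k l : ℝ} (hk : 0 < k) (hl : 0 < l) {s : Set ℝ}
    (hs : MeasurableSet s) :
    chiSquaredMul k l s =
      ∫⁻ z₁, chiSquared l ((fun z₂ => z₁ * z₂) ⁻¹' s) ∂(chiSquared k) := by
  have := isProbabilityMeasure_chiSquared hk
  have := isProbabilityMeasure_chiSquared hl
  rw [chiSquaredMul, Measure.map_apply (by fun_prop) hs, chiSquaredPair,
    Measure.prod_apply (measurableSet_preimage (by fun_prop) hs)]
  rfl

lemma nullSingletonClass_chiSquaredMul {k l : ℝ} (hk : 0 < k) (hl : 0 < l) :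
    NullSingletonClass (chiSquaredMul k l) := by
  refine ⟨fun t => ?_⟩
  rw [chiSquaredMul_apply hk hl (measurableSet_singleton t), ← lintegral_zero (μ := chiSquared k)]
  refine lintegral_congr_ae ?_
  filter_upwards [ae_pos_chiSquared k] with z hz
  have : (fun z₂ => z * z₂) ⁻¹' {t} = {t / z} := by
    ext w
    simp only [Set.mem_preimage, Set.mem_singleton_iff, eq_div_iff hz.ne', mul_comm]
  rw [this]
  exact chiSquared_absolutelyContinuous l (by simp)

lemma chiSquaredMul_pos_of_Ioo {k l s t : ℝ} (hk : 0 < k) (hl : 0 < l) (hs : 0 ≤ s)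
    (hst : s < t) : chiSquaredMul k l (Set.Ioo s t) ≠ 0 := by
  have := isProbabilityMeasure_chiSquared hk
  have := isProbabilityMeasure_chiSquared hl
  intro h
  have hm : Measurable fun z₁ => chiSquared l ((fun z₂ => z₁ * z₂) ⁻¹' Set.Ioo s t) :=
    measurable_measure_prodMk_left (s := (fun z : ℝ × ℝ => z.1 * z.2) ⁻¹' Set.Ioo s t)
      (measurableSet_preimage (by fun_prop) measurableSet_Ioo)
  rw [chiSquaredMul_apply hk hl measurableSet_Ioo, lintegral_eq_zero_iff hm] at h
  have h2 : ∀ᵐ _ ∂(chiSquared k), False := by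
    filter_upwards [h, ae_pos_chiSquared k] with z hz hz0
    have : (fun z₂ => z * z₂) ⁻¹' Set.Ioo s t = Set.Ioo (s / z) (t / z) := by
      ext w
      simp [div_lt_iff₀ hz0, lt_div_iff₀ hz0, mul_comm]
    rw [this] at hz
    exact chiSquared_pos_of_Ioo hl (by positivity) (by gcongr) hz
  simp at h2
  exact (IsProbabilityMeasure.ne_zero (chiSquared k)) h2

/-- The first two moments of the product determine the unordered pair of degrees of freedom. -/
lemma eq_or_eq_of_chiSquaredMul_eq {k l k' l' : ℝ} (hk : 0 < k) (hl : 0 < l) (hk' : 0 < k')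
    (hl' : 0 < l') (h : chiSquaredMul k l = chiSquaredMul k' l') :
    (k = k' ∧ l = l') ∨ (k = l' ∧ l = k') := by
  have first : ∀ {k l : ℝ}, 0 < k → 0 < l →
      ∫⁻ w, ENNReal.ofReal w ∂(chiSquaredMul k l) = ENNReal.ofReal (k * l) := by
    intro k l hk hl
    rw [lintegral_chiSquaredMul hk hl ENNReal.measurable_ofReal, ENNReal.ofReal_mul hk.le,
      ← lintegral_id_chiSquared hk, ← lintegral_id_chiSquared hl,
      ← lintegral_mul_const _ ENNReal.measurable_ofReal]
    refine lintegral_congr_ae ?_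
    filter_upwards [ae_pos_chiSquared k] with z hz
    rw [← lintegral_const_mul _ ENNReal.measurable_ofReal]
    simp_rw [ENNReal.ofReal_mul hz.le]
  have second : ∀ {k l : ℝ}, 0 < k → 0 < l →
      ∫⁻ w, ENNReal.ofReal w ^ 2 ∂(chiSquaredMul k l) =
        ENNReal.ofReal ((k * (k + 2)) * (l * (l + 2))) := by
    intro k l hk hl
    rw [lintegral_chiSquaredMul hk hl (ENNReal.measurable_ofReal.pow_const 2),
      ENNReal.ofReal_mul (by positivity), ← lintegral_sq_chiSquared hk,
      ← lintegral_sq_chiSquared hl,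
      ← lintegral_mul_const _ (ENNReal.measurable_ofReal.pow_const 2)]
    refine lintegral_congr_ae ?_
    filter_upwards [ae_pos_chiSquared k] with z hz
    rw [← lintegral_const_mul _ (ENNReal.measurable_ofReal.pow_const 2)]
    simp_rw [ENNReal.ofReal_mul hz.le, mul_pow]
  have e1 := first hk hl
  rw [h, first hk' hl', ENNReal.ofReal_eq_ofReal_iff (by positivity) (by positivity)] at e1
  have e2 := second hk hl
  rw [h, second hk' hl', ENNReal.ofReal_eq_ofReal_iff (by positivity) (by positivity)] at e2
  have e3 : (k' * l') * (k + l - (k' + l')) = 0 := by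
    linear_combination (-1 / 2) * e2 + (1 / 2) * (k * l + k' * l' + 2 * (k + l) + 4) * e1
  have e4 : k + l = k' + l' := by
    rcases mul_eq_zero.1 e3 with h | h
    · exact absurd h (by positivity)
    · linarith
  have e5 : (k - k') * (k - l') = 0 := by
    linear_combination k * e4 + e1
  rcases mul_eq_zero.1 e5 with h | h
  · exact Or.inl ⟨by linarith, by linarith⟩
  · exact Or.inr ⟨by linarith, by linarith⟩

/-! ### Quantiles -/

/-- A distribution function that is continuous, vanishes at `0` and is strictly increasing on the
positive half-line attains every level `α` at a single point, the `α`-quantile. -/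
lemma exists_quantile {ν : Measure ℝ} [IsProbabilityMeasure ν] [NullSingletonClass ν]
    (hpos : ∀ᵐ w ∂ν, 0 < w) (hIoo : ∀ s t, 0 ≤ s → s < t → ν (Set.Ioo s t) ≠ 0)
    {α : ℝ} (hα : α ∈ Set.Ioo (0 : ℝ) 1) :
    0 < quantile ν α ∧ ∀ t, 0 < t →
      ((α ≤ ν.real (Set.Iic t) ↔ quantile ν α ≤ t) ∧
       (ν.real (Set.Iic t) ≤ α ↔ t ≤ quantile ν α)) := by
  have hF0 : ∀ t ≤ 0, ν.real (Set.Iic t) = 0 := by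
    intro t ht
    rw [measureReal_eq_zero_iff]
    refine measure_mono_null ?_ (ae_iff.1 hpos)
    intro w hw
    simp only [Set.mem_ofPred_eq, not_lt]
    exact le_trans hw ht
  have hcont : Continuous fun t => ν.real (Set.Iic t) := by
    have : (fun t => ν.real (Set.Iic t)) = cdf ν := by ext t; rw [cdf_eq_real]
    rw [this, continuous_iff_continuousAt]
    intro t
    rw [(monotone_cdf ν).continuousAt_iff_leftLim_eq_rightLim, StieltjesFunction.rightLim_eq]
    have h := StieltjesFunction.measure_singleton (cdf ν) t
    rw [measure_cdf, measure_singleton] at h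
    have h2 := (monotone_cdf ν).leftLim_le (le_refl t)
    have h3 := ENNReal.ofReal_eq_zero.1 h.symm
    linarith
  have hstrict : ∀ s t, 0 ≤ s → s < t → ν.real (Set.Iic s) < ν.real (Set.Iic t) := by
    intro s t hs hst
    have h1 : ν.real (Set.Iic t) = ν.real (Set.Iic s) + ν.real (Set.Ioc s t) := by
      rw [← measureReal_union _ measurableSet_Ioc, Set.Iic_union_Ioc_eq_Iic hst.le]
      exact Set.disjoint_left.2 fun w hw hw' => not_lt.2 hw hw'.1
    have h2 : 0 < ν.real (Set.Ioc s t) := by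
      rw [measureReal_def, ENNReal.toReal_pos_iff]
      refine ⟨lt_of_lt_of_le (pos_iff_ne_zero.2 (hIoo s t hs hst))
        (measure_mono Set.Ioo_subset_Ioc_self), measure_lt_top _ _⟩
    linarith
  obtain ⟨q, hq⟩ : ∃ q, ν.real (Set.Iic q) = α := by
    have hlim : Filter.Tendsto (fun t => ν.real (Set.Iic t)) Filter.atTop (nhds 1) := by
      exact (tendsto_cdf_atTop ν).congr fun t => cdf_eq_real ν t
    obtain ⟨T, hT⟩ := (hlim.eventually (lt_mem_nhds hα.2)).exists
    have := intermediate_value_univ 0 T hcont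
    exact this ⟨by rw [hF0 0 le_rfl]; exact hα.1.le, hT.le⟩
  have hq0 : 0 < q := by
    by_contra h
    rw [hF0 q (not_lt.1 h)] at hq
    exact hα.1.ne hq
  have hle : ∀ t, α ≤ ν.real (Set.Iic t) ↔ q ≤ t := by
    intro t
    constructor
    · intro h
      by_contra! hlt
      rcases le_or_gt t 0 with ht | ht
      · rw [hF0 t ht] at h
        exact not_lt.2 h hα.1
      · have := hstrict t q ht.le hlt
        linarith
    · intro h
      rw [← hq]
      exact measureReal_mono (Set.Iic_subset_Iic.2 h)
  have hquant : quantile ν α = q := by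
    rw [quantile]
    simp_rw [hle]
    exact csInf_Ici
  rw [hquant]
  refine ⟨hq0, fun t ht => ⟨hle t, ?_⟩⟩
  constructor
  · intro h
    by_contra! hlt
    have := hstrict q t hq0.le hlt
    linarith
  · intro h
    rw [← hq]
    exact measureReal_mono (Set.Iic_subset_Iic.2 h)

/-- If `W` has law `ν`, then the upper quantile of `D / W` is `D` over the lower quantile
of `W`. -/
lemma quantile_map_div {ν : Measure ℝ} [IsProbabilityMeasure ν] [NullSingletonClass ν]
    (hpos : ∀ᵐ w ∂ν, 0 < w) (hIoo : ∀ s t, 0 ≤ s → s < t → ν (Set.Ioo s t) ≠ 0)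
    {α D : ℝ} (hα : α ∈ Set.Ioo (0 : ℝ) 1) (hD : 0 < D) :
    quantile (ν.map fun w => D / w) (1 - α) = D / quantile ν α := by
  obtain ⟨hq0, hq⟩ := exists_quantile hpos hIoo hα
  have hset : {t | 1 - α ≤ (ν.map fun w => D / w).real (Set.Iic t)} =
      Set.Ici (D / quantile ν α) := by
    ext t
    rw [Set.mem_ofPred_eq, Set.mem_Ici,
      map_measureReal_apply (by fun_prop) measurableSet_Iic]
    rcases le_or_gt t 0 with ht | ht
    · have h0 : ν.real ((fun w => D / w) ⁻¹' Set.Iic t) = 0 := by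
        rw [measureReal_eq_zero_iff]
        refine measure_mono_null ?_ (ae_iff.1 hpos)
        intro w hw hw'
        have : 0 < D / w := by positivity
        exact not_lt.2 (le_trans hw ht) this
      rw [h0]
      have : 0 < D / quantile ν α := by positivity
      constructor
      · intro h; linarith [hα.2]
      · intro h; linarith
    · have h1 : ν.real ((fun w => D / w) ⁻¹' Set.Iic t) = 1 - ν.real (Set.Iic (D / t)) := by
        rw [← probReal_compl_eq_one_sub measurableSet_Iic]
        refine measureReal_congr ?_
        have hne : ∀ᵐ w ∂ν, w ≠ D / t := by simp [ae_iff]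
        filter_upwards [hpos, hne] with w hw hw'
        refine propext ?_
        change D / w ≤ t ↔ ¬ (w ≤ D / t)
        rw [div_le_iff₀ hw, le_div_iff₀ ht, not_le, mul_comm w t]
        refine ⟨fun h => lt_of_le_of_ne h ?_, le_of_lt⟩
        intro h'
        exact hw' (by rw [h']; field_simp)
      rw [h1, sub_le_sub_iff_left, (hq (D / t) (by positivity)).2, div_le_iff₀ ht,
        div_le_iff₀ hq0, mul_comm]
  rw [quantile, hset, csInf_Ici]

/-! ### Standard Gaussian vectors -/

/-- The Gram determinant of two vectors is the squared length of the first times the squared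
distance of the second from the line through the first. -/
lemma gram_eq_norm_sq_mul_norm_sq_projection {E : Type*} [NormedAddCommGroup E]
    [InnerProductSpace ℝ E] {u : E} (hu : u ≠ 0) (v : E) :
    ‖u‖ ^ 2 * ‖v‖ ^ 2 - ⟪u, v⟫ ^ 2 =
      ‖u‖ ^ 2 * ‖(Submodule.span ℝ {u})ᗮ.orthogonalProjectionOnto v‖ ^ 2 := by
  have h := (Submodule.span ℝ {u}).norm_sq_eq_add_norm_sq_starProjection v
  have h2 : ‖(Submodule.span ℝ {u})ᗮ.starProjection v‖ =
    ‖(Submodule.span ℝ {u})ᗮ.orthogonalProjectionOnto v‖ := rfl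
  have hu' : ‖u‖ ≠ 0 := norm_ne_zero_iff.2 hu
  rw [Submodule.starProjection_singleton, norm_smul, h2] at h
  rw [h, mul_pow, Real.norm_eq_abs, sq_abs]
  simp only [RCLike.ofReal_real_eq_id, id_eq]
  field_simp
  ring

section StdGaussian

variable {E : Type*} [NormedAddCommGroup E] [InnerProductSpace ℝ E] [FiniteDimensional ℝ E]
  [MeasurableSpace E] [BorelSpace E]

/-- The Lebesgue density of the standard Gaussian law, identified through its characteristic
function. -/
lemma stdGaussian_eq_withDensity :
    stdGaussian E = (volume : Measure E).withDensity fun v => ENNReal.ofReal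
      (((2 * Real.pi) ^ (Module.finrank ℝ E / 2 : ℝ))⁻¹ * Real.exp (-(1 / 2) * ‖v‖ ^ 2)) := by
  set C : ℝ := (2 * Real.pi) ^ (Module.finrank ℝ E / 2 : ℝ) with hC
  have hCpos : 0 < C := by positivity
  have hint : Integrable (fun v : E => C⁻¹ * Real.exp (-(1 / 2) * ‖v‖ ^ 2)) := by
    have := (GaussianFourier.integrable_cexp_neg_mul_sq_norm_add (V := E) (b := 1 / 2)
      (by norm_num) 0 0).re
    refine Integrable.const_mul (this.congr (ae_of_all _ fun v => ?_)) _
    have : (-(1 / 2 : ℂ) * (‖v‖ : ℂ) ^ 2 + 0 * ((⟪(0 : E), v⟫ : ℝ) : ℂ)) =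
        ((-(1 / 2) * ‖v‖ ^ 2 : ℝ) : ℂ) := by push_cast; ring
    simp only [this]
    rw [← Complex.ofReal_exp]
    rfl
  have hmeas : Measurable (fun v : E => C⁻¹ * Real.exp (-(1 / 2) * ‖v‖ ^ 2)) := by fun_prop
  have : IsFiniteMeasure ((volume : Measure E).withDensity fun v => ENNReal.ofReal
      (C⁻¹ * Real.exp (-(1 / 2) * ‖v‖ ^ 2))) := isFiniteMeasure_withDensity_ofReal hint.2
  refine Measure.ext_of_charFun ?_
  ext t
  rw [charFun_stdGaussian, charFun_apply,
    integral_withDensity_eq_integral_toReal_smul hmeas.ennreal_ofReal (by simp)]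
  have key := GaussianFourier.integral_cexp_neg_mul_sq_norm_add (V := E) (b := 1 / 2)
    (by norm_num) Complex.I t
  have e1 : ∀ v : E, (ENNReal.ofReal (C⁻¹ * Real.exp (-(1 / 2) * ‖v‖ ^ 2))).toReal •
      Complex.exp ((⟪v, t⟫ : ℝ) * Complex.I) =
      (C : ℂ)⁻¹ * Complex.exp (-(1 / 2) * (‖v‖ : ℂ) ^ 2 + Complex.I * (⟪t, v⟫ : ℝ)) := by
    intro v
    rw [ENNReal.toReal_ofReal (by positivity), Complex.real_smul, Complex.exp_add,
      real_inner_comm v t]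
    push_cast
    ring_nf
  simp_rw [e1]
  rw [integral_const_mul, key]
  have e2 : ((Real.pi : ℂ) / (1 / 2)) ^ (Module.finrank ℝ E / 2 : ℂ) = (C : ℂ) := by
    rw [hC, Complex.ofReal_cpow (by positivity)]
    push_cast
    congr 1
    ring
  rw [e2, ← mul_assoc, inv_mul_cancel₀ (by exact_mod_cast hCpos.ne'), one_mul, Complex.I_sq]
  congr 1
  ring

lemma chiSquared_real_apply {k : ℝ} (hk : 0 < k) {s : Set ℝ} (hs : MeasurableSet s) :
    (chiSquared k).real s = ∫ z in Set.Ioi 0, s.indicator 1 z *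
      ((1 / 2) ^ (k / 2) / Real.Gamma (k / 2) * z ^ (k / 2 - 1) * Real.exp (-(1 / 2 * z))) := by
  have h1 : (chiSquared k).real s = ∫ z in s, gammaPDFReal (k / 2) (1 / 2) z := by
    rw [chiSquared, gammaMeasure, measureReal_def, withDensity_apply _ hs]
    refine (integral_eq_lintegral_of_nonneg_ae ?_ ?_).symm
    · exact ae_of_all _ fun b => by simp [gammaPDFReal_nonneg (show 0 < k / 2 by positivity)]
    · fun_prop
  rw [h1, ← integral_indicator hs, ← integral_Ici_eq_integral_Ioi,
    ← integral_indicator measurableSet_Ici]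
  congr 1
  ext z
  by_cases hz : z ∈ s <;> by_cases hz' : 0 ≤ z <;> simp [gammaPDFReal, Set.indicator, hz, hz']

/-- The squared length of a standard Gaussian vector is chi-squared distributed. Integration in
polar coordinates identifies the two densities up to a constant, which is `1` since both sides
are probability measures. -/
lemma map_norm_sq_stdGaussian [Nontrivial E] :
    (stdGaussian E).map (fun v => ‖v‖ ^ 2) = chiSquared (Module.finrank ℝ E) := by
  set d := Module.finrank ℝ E with hd
  have hd0 : 0 < d := Module.finrank_pos
  have hdR : (0 : ℝ) < d := by exact_mod_cast hd0
  have := isProbabilityMeasure_chiSquared hdR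
  have : IsProbabilityMeasure ((stdGaussian E).map (fun v => ‖v‖ ^ 2)) :=
    Measure.isProbabilityMeasure_map (by fun_prop)
  set c : ℝ := ((2 * Real.pi) ^ (d / 2 : ℝ))⁻¹ with hc
  set K : ℝ := (1 / 2) ^ (d / 2 : ℝ) / Real.Gamma (d / 2) with hK
  have hKpos : 0 < K := by
    have := Real.Gamma_pos_of_pos (show (0 : ℝ) < d / 2 by positivity)
    positivity
  obtain ⟨A, hA⟩ : ∃ A : ℝ, ∀ s, MeasurableSet s →
      ((stdGaussian E).map (fun v => ‖v‖ ^ 2)).real s = A * (chiSquared d).real s := by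
    refine ⟨d * (volume : Measure E).real (Metric.ball 0 1) * (c / (2 * K)), fun s hs => ?_⟩
    rw [map_measureReal_apply (by fun_prop) hs, chiSquared_real_apply hdR hs,
      ← integral_comp_rpow_Ioi_of_pos (p := 2) (by norm_num)]
    have h1 : (stdGaussian E).real ((fun v => ‖v‖ ^ 2) ⁻¹' s) =
        ∫ v : E, s.indicator 1 (‖v‖ ^ 2) * (c * Real.exp (-(1 / 2) * ‖v‖ ^ 2)) := by
      rw [← integral_indicator_one (measurableSet_preimage (by fun_prop) hs),
        stdGaussian_eq_withDensity, integral_withDensity_eq_integral_toReal_smul (by fun_prop)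
        (by simp)]
      congr 1
      ext v
      rw [ENNReal.toReal_ofReal (by positivity), smul_eq_mul, mul_comm]
      rfl
    rw [h1, integral_fun_norm_addHaar (volume : Measure E)
      (fun y => s.indicator 1 (y ^ 2) * (c * Real.exp (-(1 / 2) * y ^ 2))), ← hd]
    rw [nsmul_eq_mul, smul_eq_mul, ← integral_const_mul, ← integral_const_mul,
      ← integral_const_mul]
    refine setIntegral_congr_fun measurableSet_Ioi fun y (hy : 0 < y) => ?_
    have e1 : (y ^ (2 : ℝ)) ^ ((d : ℝ) / 2 - 1) * y = y ^ (d - 1) := by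
      rw [← Real.rpow_natCast y (d - 1), ← Real.rpow_mul hy.le, Nat.cast_sub (by omega)]
      nth_rewrite 2 [← Real.rpow_one y]
      rw [← Real.rpow_add hy]
      congr 1
      push_cast
      ring
    have e2 : y ^ (2 : ℝ) = y ^ 2 := Real.rpow_two y
    have e3 : (2 : ℝ) - 1 = 1 := by norm_num
    simp only [smul_eq_mul, e3, Real.rpow_one]
    rw [← hK, ← e1, e2]
    field_simp
  have hA1 : A = 1 := by
    have := hA Set.univ MeasurableSet.univ
    simpa using this.symm
  refine Measure.ext fun s hs => ?_
  rw [← ENNReal.toReal_eq_toReal_iff' (measure_ne_top _ _) (measure_ne_top _ _)]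
  have := hA s hs
  rw [hA1, one_mul] at this
  exact this

/-- Orthogonal projections of standard Gaussian vectors are standard Gaussian. -/
lemma map_orthogonalProjectionOnto_stdGaussian (W : Submodule ℝ E) :
    (stdGaussian E).map W.orthogonalProjectionOnto = stdGaussian W := by
  refine Measure.ext_of_charFun ?_
  ext t
  have h := charFun_stdGaussian (t : E)
  rw [charFun_apply] at h
  rw [charFun_stdGaussian, charFun_apply, integral_map (by fun_prop) (by fun_prop)]
  simp_rw [Submodule.inner_orthogonalProjectionOnto_eq_of_mem_right]
  rw [h]
  simp

/-- The Gram determinant of two independent standard Gaussian vectors in dimension `d + 1` is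
distributed as a product of independent chi-squared variables with `d + 1` and `d` degrees of
freedom: given the first vector, the part of the second one that is orthogonal to it is standard
Gaussian in dimension `d`. -/
lemma map_gram_stdGaussian {d : ℕ} (hd : 0 < d) (hE : Module.finrank ℝ E = d + 1) :
    ((stdGaussian E).prod (stdGaussian E)).map
      (fun p => ‖p.1‖ ^ 2 * ‖p.2‖ ^ 2 - ⟪p.1, p.2⟫ ^ 2) = chiSquaredMul (d + 1) d := by
  have hd' : (0 : ℝ) < d := by exact_mod_cast hd
  have : Nontrivial E := Module.nontrivial_of_finrank_pos (R := ℝ) (by omega)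
  have : Fact (Module.finrank ℝ E = d + 1) := ⟨hE⟩
  refine Measure.ext_of_lintegral _ fun f hf => ?_
  rw [lintegral_chiSquaredMul (by positivity) hd' hf, lintegral_map hf (by fun_prop),
    lintegral_prod _ (by fun_prop)]
  have hE' : chiSquared ((d : ℝ) + 1) = (stdGaussian E).map (fun v => ‖v‖ ^ 2) := by
    rw [map_norm_sq_stdGaussian, hE]; push_cast; rfl
  have := isProbabilityMeasure_chiSquared hd'
  have hm : Measurable fun z₁ : ℝ => ∫⁻ z₂, f (z₁ * z₂) ∂(chiSquared (d : ℝ)) :=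
    Measurable.lintegral_prod_right' (f := fun p : ℝ × ℝ => f (p.1 * p.2)) (by fun_prop)
  rw [hE', lintegral_map hm (by fun_prop)]
  refine lintegral_congr_ae ?_
  have h0 : ∀ᵐ u ∂(stdGaussian E), u ≠ 0 := by
    have : stdGaussian E ≪ volume := by
      rw [stdGaussian_eq_withDensity]; exact withDensity_absolutelyContinuous _ _
    exact this.ae_le (compl_mem_ae_iff.2 (measure_singleton 0))
  filter_upwards [h0] with u hu
  have hfin : Module.finrank ℝ (Submodule.span ℝ {u})ᗮ = d :=
    Submodule.finrank_orthogonal_span_singleton hu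
  have : Nontrivial (Submodule.span ℝ {u})ᗮ :=
    Module.nontrivial_of_finrank_pos (R := ℝ) (by omega)
  have hchi : chiSquared (d : ℝ) = (stdGaussian E).map
      (fun v => ‖(Submodule.span ℝ {u})ᗮ.orthogonalProjectionOnto v‖ ^ 2) := by
    rw [← hfin, ← map_norm_sq_stdGaussian, ← map_orthogonalProjectionOnto_stdGaussian,
      Measure.map_map (by fun_prop) (by fun_prop)]
    rfl
  rw [hchi, lintegral_map (by fun_prop) (by fun_prop)]
  simp_rw [gram_eq_norm_sq_mul_norm_sq_projection hu]

end StdGaussian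

/-! ### The law of the scatter determinant -/

variable {n : ℕ}

/-- The vector in `ℝⁿ` of the `i`-th coordinates of the observations. -/
def column (x : Data n) (i : Fin 2) : EuclideanSpace ℝ (Fin n) :=
  WithLp.toLp 2 fun k => x k i

@[fun_prop]
lemma measurable_column (i : Fin 2) : Measurable fun x : Data n => column x i := by
  unfold column
  fun_prop

/-- The space of centred vectors, the orthogonal complement of the constant vectors in `ℝⁿ`. -/
abbrev centredSpace (n : ℕ) : Submodule ℝ (EuclideanSpace ℝ (Fin n)) :=
  (Submodule.span ℝ {WithLp.toLp 2 fun _ : Fin n => (1 : ℝ)})ᗮ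

lemma norm_sq_ones : ‖(WithLp.toLp 2 fun _ : Fin n => (1 : ℝ))‖ ^ 2 = n := by
  simp [EuclideanSpace.real_norm_sq_eq]

lemma finrank_centredSpace (hn : 1 ≤ n) : Module.finrank ℝ (centredSpace n) = n - 1 := by
  have : Fact (Module.finrank ℝ (EuclideanSpace ℝ (Fin n)) = (n - 1) + 1) :=
    ⟨by rw [finrank_euclideanSpace_fin]; omega⟩
  refine Submodule.finrank_orthogonal_span_singleton ?_
  intro h
  have h2 := norm_sq_ones (n := n)
  rw [h, norm_zero, zero_pow two_ne_zero] at h2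
  have : n = 0 := by exact_mod_cast h2.symm
  omega

lemma orthogonalProjectionOnto_column (x : Data n) (i : Fin 2) (k : Fin n) :
    ((centredSpace n).orthogonalProjectionOnto (column x i) : EuclideanSpace ℝ (Fin n)) k =
      x k i - sampleMean x i := by
  rw [← Submodule.starProjection_apply, Submodule.starProjection_orthogonal_val,
    Submodule.starProjection_singleton]
  simp only [RCLike.ofReal_real_eq_id, id_eq, norm_sq_ones]
  simp [column, PiLp.inner_apply, sampleMean]

lemma scatter_eq_inner (x : Data n) (i j : Fin 2) :
    scatter x i j = ⟪(centredSpace n).orthogonalProjectionOnto (column x i),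
      (centredSpace n).orthogonalProjectionOnto (column x j)⟫ := by
  rw [Submodule.coe_inner, PiLp.inner_apply]
  simp only [orthogonalProjectionOnto_column]
  simp [scatter, mul_comm]

lemma det_scatter_eq_gram (x : Data n) :
    (scatter x).det = ‖(centredSpace n).orthogonalProjectionOnto (column x 0)‖ ^ 2 *
      ‖(centredSpace n).orthogonalProjectionOnto (column x 1)‖ ^ 2 -
      ⟪(centredSpace n).orthogonalProjectionOnto (column x 0),
        (centredSpace n).orthogonalProjectionOnto (column x 1)⟫ ^ 2 := by
  rw [Matrix.det_fin_two]
  simp only [scatter_eq_inner, real_inner_self_eq_norm_sq]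
  rw [real_inner_comm ((centredSpace n).orthogonalProjectionOnto (column x 1))]
  ring

/-- The two columns of a standard Gaussian sample are independent standard Gaussian vectors. -/
lemma map_columns_stdGaussian :
    (Measure.pi fun _ : Fin n => stdGaussian (EuclideanSpace ℝ (Fin 2))).map
      (fun x => (column x 0, column x 1)) =
    (stdGaussian (EuclideanSpace ℝ (Fin n))).prod (stdGaussian (EuclideanSpace ℝ (Fin n))) := by
  -- The sample is an `n × 2` array of independent standard normal variables, read by rows or by
  -- columns.
  have h2 : (stdGaussian (EuclideanSpace ℝ (Fin 2))) =
      ((gaussianReal 0 1).prod (gaussianReal 0 1)).map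
        (fun p => WithLp.toLp 2 (![p.1, p.2] : Fin 2 → ℝ)) := by
    rw [← map_pi_eq_stdGaussian, ← ((measurePreserving_piFinTwo
      (fun _ => gaussianReal 0 1)).symm).map_eq, Measure.map_map (by fun_prop) (by fun_prop)]
    rfl
  have hm : Measurable (fun p : ℝ × ℝ => WithLp.toLp 2 (![p.1, p.2] : Fin 2 → ℝ)) := by
    refine (PiLp.continuous_toLp 2 _).measurable.comp (measurable_pi_iff.2 fun i => ?_)
    fin_cases i
    · exact measurable_fst
    · exact measurable_snd
  have : IsProbabilityMeasure (((gaussianReal 0 1).prod (gaussianReal 0 1)).map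
        (fun p => WithLp.toLp 2 (![p.1, p.2] : Fin 2 → ℝ))) :=
    Measure.isProbabilityMeasure_map hm.aemeasurable
  rw [h2, ← Measure.pi_map_pi (fun _ => hm.aemeasurable),
    Measure.map_map (by fun_prop) (by fun_prop), ← map_pi_eq_stdGaussian,
    Measure.map_prod_map _ _ (by fun_prop) (by fun_prop),
    ← (measurePreserving_arrowProdEquivProdArrow ℝ ℝ (Fin n) (fun _ => gaussianReal 0 1)
      (fun _ => gaussianReal 0 1)).map_eq, Measure.map_map (by fun_prop) (by fun_prop)]
  rfl

lemma map_det_scatter_stdGaussian (hn : 3 ≤ n) :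
    (Measure.pi fun _ : Fin n => stdGaussian (EuclideanSpace ℝ (Fin 2))).map
      (fun x => (scatter x).det) = chiSquaredMul (n - 1) (n - 2) := by
  have hfin := finrank_centredSpace (n := n) (by omega)
  have h := map_gram_stdGaussian (E := centredSpace n) (d := n - 2) (by omega) (by omega)
  have hc : ((n - 2 : ℕ) : ℝ) = (n : ℝ) - 2 := by push_cast [show 2 ≤ n by omega]; ring
  rw [hc, show (n : ℝ) - 2 + 1 = n - 1 by ring] at h
  rw [← h, ← map_orthogonalProjectionOnto_stdGaussian,
    Measure.map_prod_map _ _ (by fun_prop) (by fun_prop), ← map_columns_stdGaussian,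
    Measure.map_map (by fun_prop) (by fun_prop),
    Measure.map_map (by fun_prop) (by fun_prop)]
  congr 1
  ext x
  exact det_scatter_eq_gram x

/-- An affine change of the observations acts on the scatter matrix by congruence. -/
lemma scatter_affine (hn : n ≠ 0) (m : EuclideanSpace ℝ (Fin 2)) (A : Matrix (Fin 2) (Fin 2) ℝ)
    (x : Data n) :
    scatter (fun k => m + Matrix.toEuclideanCLM (𝕜 := ℝ) A (x k)) =
      A * scatter x * A.transpose := by
  have hn' : (n : ℝ) ≠ 0 := by exact_mod_cast hn
  have hc : ∀ k i, (m + Matrix.toEuclideanCLM (𝕜 := ℝ) A (x k)) i =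
      m i + (A i 0 * x k 0 + A i 1 * x k 1) := by
    intro k i
    simp [Matrix.mulVec, dotProduct, Fin.sum_univ_two]
  have hmean : ∀ i, sampleMean (fun k => m + Matrix.toEuclideanCLM (𝕜 := ℝ) A (x k)) i =
      m i + (A i 0 * sampleMean x 0 + A i 1 * sampleMean x 1) := by
    intro i
    simp only [sampleMean, hc, Finset.sum_add_distrib, ← Finset.mul_sum]
    simp only [Finset.sum_const, Finset.card_univ, Fintype.card_fin, nsmul_eq_mul]
    field_simp
  ext i j
  simp only [scatter, Matrix.of_apply, hc, hmean, Matrix.mul_apply, Fin.sum_univ_two,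
    Matrix.transpose_apply]
  simp only [Finset.mul_sum, Finset.sum_mul, ← Finset.sum_add_distrib]
  refine Finset.sum_congr rfl fun k _ => ?_
  ring

lemma genVar_eq (σ₁ σ₂ ρ : ℝ) : genVar σ₁ σ₂ ρ = σ₁ ^ 2 * (σ₂ ^ 2 * (1 - ρ ^ 2)) := by
  rw [genVar, covMatrix, Matrix.det_fin_two_of]
  ring

lemma genVar_pos {σ₁ σ₂ ρ : ℝ} (h₁ : 0 < σ₁) (h₂ : 0 < σ₂) (hρ : ρ ∈ Set.Ioo (-1 : ℝ) 1) :
    0 < genVar σ₁ σ₂ ρ := by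
  have : 0 < 1 - ρ ^ 2 := by nlinarith [hρ.1, hρ.2]
  rw [genVar_eq]
  positivity

lemma posSemidef_covMatrix {σ₁ σ₂ ρ : ℝ} (hρ : ρ ∈ Set.Ioo (-1 : ℝ) 1) :
    (covMatrix σ₁ σ₂ ρ).PosSemidef := by
  refine Matrix.PosSemidef.of_dotProduct_mulVec_nonneg ?_ fun v => ?_
  · ext i j
    fin_cases i <;> fin_cases j <;> simp [covMatrix]
  · have h : 0 ≤ 1 - ρ ^ 2 := by nlinarith [hρ.1, hρ.2]
    have : star v ⬝ᵥ (covMatrix σ₁ σ₂ ρ).mulVec v =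
        (σ₁ * v 0 + ρ * σ₂ * v 1) ^ 2 + (1 - ρ ^ 2) * (σ₂ * v 1) ^ 2 := by
      simp [covMatrix, dotProduct, Matrix.mulVec, Fin.sum_univ_two]
      ring
    rw [this]
    positivity

lemma measurable_det_scatter : Measurable fun x : Data n => (scatter x).det := by
  simp only [Matrix.det_fin_two, scatter, sampleMean, Matrix.of_apply]
  fun_prop

/-- Under the sampling law, `|S| / |Σ|` is a product of independent chi-squared variables with
`n - 1` and `n - 2` degrees of freedom. -/
lemma map_det_scatter_div_samplingLaw (hn : 3 ≤ n) (μ₁ μ₂ : ℝ) {σ₁ σ₂ ρ : ℝ} (h₁ : 0 < σ₁)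
    (h₂ : 0 < σ₂) (hρ : ρ ∈ Set.Ioo (-1 : ℝ) 1) :
    (samplingLaw n μ₁ μ₂ σ₁ σ₂ ρ).map (fun x => (scatter x).det / genVar σ₁ σ₂ ρ) =
      chiSquaredMul (n - 1) (n - 2) := by
  open scoped MatrixOrder in
  set A := CFC.sqrt (covMatrix σ₁ σ₂ ρ) with hA
  have hAA : A * A = covMatrix σ₁ σ₂ ρ :=
    CFC.sqrt_mul_sqrt_self _ (posSemidef_covMatrix hρ).nonneg
  have hdet : A.det * A.det = genVar σ₁ σ₂ ρ := by rw [← Matrix.det_mul, hAA, genVar]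
  have hlaw : samplingLaw n μ₁ μ₂ σ₁ σ₂ ρ =
      (Measure.pi fun _ : Fin n => stdGaussian (EuclideanSpace ℝ (Fin 2))).map
        (fun x k => !₂[μ₁, μ₂] + Matrix.toEuclideanCLM (𝕜 := ℝ) A (x k)) := by
    have : IsProbabilityMeasure ((stdGaussian (EuclideanSpace ℝ (Fin 2))).map
        (fun y => !₂[μ₁, μ₂] + Matrix.toEuclideanCLM (𝕜 := ℝ) A y)) :=
      Measure.isProbabilityMeasure_map (by fun_prop)
    exact (Measure.pi_map_pi (μ := fun _ : Fin n => stdGaussian (EuclideanSpace ℝ (Fin 2)))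
      (f := fun _ y => !₂[μ₁, μ₂] + Matrix.toEuclideanCLM (𝕜 := ℝ) A y)
      (fun _ => by fun_prop)).symm
  have hm : Measurable fun x : Data n => (scatter x).det / genVar σ₁ σ₂ ρ :=
    measurable_det_scatter.div_const _
  rw [hlaw, ← map_det_scatter_stdGaussian hn, Measure.map_map hm (by fun_prop)]
  congr 1
  ext x
  have hpos := genVar_pos h₁ h₂ hρ
  simp only [Function.comp_apply]
  rw [scatter_affine (by omega), Matrix.det_mul, Matrix.det_mul, Matrix.det_transpose,
    div_eq_iff hpos.ne', ← hdet]
  ring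

/-! ### Changes of variables -/

lemma lintegral_Ioi_comp_mul {c : ℝ} (hc : 0 < c) (F : ℝ → ℝ≥0∞) :
    ∫⁻ x in Set.Ioi 0, ENNReal.ofReal c * F (x * c) = ∫⁻ y in Set.Ioi 0, F y := by
  have himg : (fun x : ℝ => x * c) '' Set.Ioi 0 = Set.Ioi 0 := by
    ext y
    simp only [Set.mem_image, Set.mem_Ioi]
    constructor
    · rintro ⟨x, hx, rfl⟩; positivity
    · intro hy; exact ⟨y / c, by positivity, by field_simp⟩
  have h := lintegral_image_eq_lintegral_abs_deriv_mul (s := Set.Ioi 0) (f := fun x : ℝ => x * c)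
    (f' := fun _ => c) measurableSet_Ioi
    (fun x _ => by simpa using ((hasDerivAt_id x).mul_const c).hasDerivWithinAt)
    (fun x _ y _ hxy => mul_right_cancel₀ hc.ne' hxy) F
  rw [himg, abs_of_pos hc] at h
  exact h.symm

lemma one_sub_sq_pos {ρ : ℝ} (hρ : ρ ∈ Set.Ioo (-1 : ℝ) 1) : 0 < 1 - ρ ^ 2 := by
  nlinarith [hρ.1, hρ.2]

/-- Substitution `β = c * ρ / √(1 - ρ ^ 2)`, a bijection from `(-1, 1)` to `ℝ`. -/
lemma lintegral_Ioo_comp_div_sqrt {c : ℝ} (hc : 0 < c) (F : ℝ → ℝ≥0∞) :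
    ∫⁻ ρ in Set.Ioo (-1 : ℝ) 1, ENNReal.ofReal (c / √(1 - ρ ^ 2) ^ 3) *
      F (c * (ρ / √(1 - ρ ^ 2))) = ∫⁻ β, F β := by
  have hleft : ∀ ρ ∈ Set.Ioo (-1 : ℝ) 1,
      (ρ / √(1 - ρ ^ 2)) / √(1 + (ρ / √(1 - ρ ^ 2)) ^ 2) = ρ := by
    intro ρ hρ
    have h1 := one_sub_sq_pos hρ
    have h2 : 1 + (ρ / √(1 - ρ ^ 2)) ^ 2 = (1 - ρ ^ 2)⁻¹ := by
      rw [div_pow, Real.sq_sqrt h1.le]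
      field_simp
      ring
    rw [h2, Real.sqrt_inv]
    have : √(1 - ρ ^ 2) ≠ 0 := (Real.sqrt_pos.2 h1).ne'
    field_simp
  have himg : (fun ρ : ℝ => c * (ρ / √(1 - ρ ^ 2))) '' Set.Ioo (-1 : ℝ) 1 = Set.univ := by
    refine Set.eq_univ_of_forall fun y => ?_
    set u := y / c with hu
    have hpos : 0 < 1 + u ^ 2 := by positivity
    have hs := Real.sqrt_pos.2 hpos
    have hsq := Real.sq_sqrt hpos.le
    refine ⟨u / √(1 + u ^ 2), ⟨?_, ?_⟩, ?_⟩
    · rw [lt_div_iff₀ hs]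
      nlinarith [Real.abs_le_sqrt (show u ^ 2 ≤ 1 + u ^ 2 by linarith), neg_abs_le u,
        abs_nonneg u, sq_abs u]
    · rw [div_lt_iff₀ hs, one_mul]
      exact Real.lt_sqrt_of_sq_lt (by linarith)
    · have h2 : 1 - (u / √(1 + u ^ 2)) ^ 2 = (1 + u ^ 2)⁻¹ := by
        rw [div_pow, hsq]
        field_simp
        ring
      simp only [h2, Real.sqrt_inv]
      rw [div_inv_eq_mul, div_mul_cancel₀ _ hs.ne', hu]
      field_simp
  have hderiv : ∀ ρ ∈ Set.Ioo (-1 : ℝ) 1,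
      HasDerivWithinAt (fun ρ : ℝ => c * (ρ / √(1 - ρ ^ 2))) (c / √(1 - ρ ^ 2) ^ 3)
        (Set.Ioo (-1 : ℝ) 1) ρ := by
    intro ρ hρ
    have h1 := one_sub_sq_pos hρ
    have hs := Real.sqrt_pos.2 h1
    have hsq := Real.sq_sqrt h1.le
    have hd : HasDerivAt (fun ρ : ℝ => √(1 - ρ ^ 2)) (-(2 * ρ) / (2 * √(1 - ρ ^ 2))) ρ := by
      have := ((hasDerivAt_pow 2 ρ).const_sub 1).sqrt h1.ne'
      simpa using this
    have := ((hasDerivAt_id ρ).div hd hs.ne').const_mul c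
    refine (this.congr_deriv ?_).hasDerivWithinAt
    simp only [id_eq]
    field_simp
    rw [hsq]
    ring
  have hinj : Set.InjOn (fun ρ : ℝ => c * (ρ / √(1 - ρ ^ 2))) (Set.Ioo (-1 : ℝ) 1) := by
    intro x hx y hy hxy
    have := mul_left_cancel₀ hc.ne' hxy
    rw [← hleft x hx, this, hleft y hy]
  have h := lintegral_image_eq_lintegral_abs_deriv_mul measurableSet_Ioo hderiv hinj F
  rw [himg, Measure.restrict_univ] at h
  rw [h]
  refine setLIntegral_congr_fun measurableSet_Ioo fun ρ hρ => ?_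
  have := Real.sqrt_pos.2 (one_sub_sq_pos hρ)
  rw [abs_of_pos (by positivity)]

/-- Change of variables from `(σ₂, ρ)` to the residual standard deviation `τ = σ₂ √(1 - ρ²)` and
the regression coefficient `β = ρ σ₂ / σ₁`, for fixed `σ₁`. -/
lemma lintegral_regression {s : ℝ} (hs : 0 < s) {G : ℝ × ℝ → ℝ≥0∞} (hG : Measurable G) :
    ∫⁻ σ in Set.Ioi 0, ∫⁻ ρ in Set.Ioo (-1 : ℝ) 1,
      ENNReal.ofReal (σ / (s * √(1 - ρ ^ 2))) * G (σ * √(1 - ρ ^ 2), ρ * σ / s) =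
    ∫⁻ τ in Set.Ioi 0, ∫⁻ β, G (τ, β) := by
  calc _ = ∫⁻ ρ in Set.Ioo (-1 : ℝ) 1, ∫⁻ σ in Set.Ioi 0,
        ENNReal.ofReal (σ / (s * √(1 - ρ ^ 2))) * G (σ * √(1 - ρ ^ 2), ρ * σ / s) :=
      lintegral_lintegral_swap (by fun_prop)
    _ = ∫⁻ ρ in Set.Ioo (-1 : ℝ) 1, ∫⁻ τ in Set.Ioi 0,
        ENNReal.ofReal ((τ / s) / √(1 - ρ ^ 2) ^ 3) * G (τ, (τ / s) * (ρ / √(1 - ρ ^ 2))) := by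
      refine setLIntegral_congr_fun measurableSet_Ioo fun ρ hρ => ?_
      have hc := Real.sqrt_pos.2 (one_sub_sq_pos hρ)
      refine Eq.trans ?_ (lintegral_Ioi_comp_mul hc _)
      refine setLIntegral_congr_fun measurableSet_Ioi fun σ (hσ : 0 < σ) => ?_
      rw [← mul_assoc, ← ENNReal.ofReal_mul hc.le]
      congr 2
      · field_simp
      · congr 1; field_simp
    _ = ∫⁻ τ in Set.Ioi 0, ∫⁻ ρ in Set.Ioo (-1 : ℝ) 1,
        ENNReal.ofReal ((τ / s) / √(1 - ρ ^ 2) ^ 3) * G (τ, (τ / s) * (ρ / √(1 - ρ ^ 2))) :=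
      lintegral_lintegral_swap (by fun_prop)
    _ = _ := by
      refine setLIntegral_congr_fun measurableSet_Ioi fun τ (hτ : 0 < τ) => ?_
      exact lintegral_Ioo_comp_div_sqrt (c := τ / s) (by positivity) fun β => G (τ, β)

/-- Under the density `σ ^ (-k - 1) * exp (-A / (2 σ ^ 2))`, which is integrable, `A / σ ^ 2` is
chi-squared distributed with `k` degrees of freedom. -/
lemma exists_lintegral_eq_chiSquared {k A : ℝ} (hk : 0 < k) (hA : 0 < A) :
    ∃ C : ℝ, 0 < C ∧ ∀ h : ℝ → ℝ≥0∞, Measurable h →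
      ∫⁻ σ in Set.Ioi 0, h (σ ^ 2) * ENNReal.ofReal (σ ^ (-k - 1) * Real.exp (-(A / (2 * σ ^ 2)))) =
        ENNReal.ofReal C * ∫⁻ z, h (A / z) ∂(chiSquared k) := by
  set K : ℝ := (1 / 2) ^ (k / 2) / Real.Gamma (k / 2) with hK
  have hKpos : 0 < K := by
    have := Real.Gamma_pos_of_pos (show (0 : ℝ) < k / 2 by positivity)
    positivity
  refine ⟨(2 * K * A ^ (k / 2))⁻¹, by positivity, fun h hh => ?_⟩
  have himg : (fun σ : ℝ => A / σ ^ 2) '' Set.Ioi 0 = Set.Ioi 0 := by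
    ext y
    simp only [Set.mem_image, Set.mem_Ioi]
    constructor
    · rintro ⟨x, hx, rfl⟩; positivity
    · intro hy
      refine ⟨√(A / y), Real.sqrt_pos.2 (by positivity), ?_⟩
      rw [Real.sq_sqrt (by positivity)]
      field_simp
  have hsubst := lintegral_image_eq_lintegral_abs_deriv_mul (s := Set.Ioi 0)
    (f := fun σ : ℝ => A / σ ^ 2) (f' := fun σ => -(2 * A / σ ^ 3)) measurableSet_Ioi
    (fun σ (hσ : 0 < σ) => by
      have := (hasDerivAt_const σ A).div (hasDerivAt_pow 2 σ) (by positivity)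
      refine (this.congr_deriv ?_).hasDerivWithinAt
      simp
      field_simp)
    (fun x (hx : 0 < x) y (hy : 0 < y) hxy => by
      have h2 : x ^ 2 = y ^ 2 := by
        have h3 : A / x ^ 2 = A / y ^ 2 := hxy
        field_simp at h3
        exact h3.symm
      exact (pow_left_inj₀ hx.le hy.le two_ne_zero).1 h2)
    (fun z => gammaPDF (k / 2) (1 / 2) z * h (A / z))
  rw [himg] at hsubst
  have hchi : ∫⁻ z, h (A / z) ∂(chiSquared k) =
      ∫⁻ z in Set.Ioi 0, gammaPDF (k / 2) (1 / 2) z * h (A / z) := by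
    have hmem : ∀ᵐ z ∂(chiSquared k), z ∈ Set.Ioi (0 : ℝ) := ae_pos_chiSquared k
    conv_lhs => rw [← Measure.restrict_eq_self_of_ae_mem hmem]
    rw [chiSquared, gammaMeasure, setLIntegral_withDensity_eq_setLIntegral_mul _
      (measurable_gammaPDF _ _) (by fun_prop) measurableSet_Ioi]
    rfl
  rw [hchi, hsubst, ← lintegral_const_mul _ (by fun_prop)]
  refine setLIntegral_congr_fun measurableSet_Ioi fun σ (hσ : 0 < σ) => ?_
  rw [abs_neg, abs_of_pos (by positivity), gammaPDF_of_nonneg (by positivity), ← hK,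
    show A / (A / σ ^ 2) = σ ^ 2 by field_simp, ← mul_assoc, ← mul_assoc, mul_comm (h _)]
  congr 1
  rw [← ENNReal.ofReal_mul (by positivity), ← ENNReal.ofReal_mul (by positivity)]
  congr 1
  have e1 : (A / σ ^ 2) ^ (k / 2 - 1) = A ^ (k / 2) / A * (σ ^ (-k - 1) * σ ^ 3) := by
    rw [Real.div_rpow hA.le (by positivity), Real.rpow_sub_one hA.ne', ← Real.rpow_natCast σ 2,
      ← Real.rpow_mul hσ.le, ← Real.rpow_natCast σ 3, ← Real.rpow_add hσ, div_eq_mul_inv _ (σ ^ _),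
      ← Real.rpow_neg hσ.le]
    congr 2
    push_cast
    ring
  rw [e1, show -(1 / 2 * (A / σ ^ 2)) = -(A / (2 * σ ^ 2)) by field_simp]
  field_simp

lemma lintegral_gaussian_sub {c : ℝ} (hc : 0 < c) (y : ℝ) :
    ∫⁻ m, ENNReal.ofReal (Real.exp (-(c * (y - m) ^ 2))) = ENNReal.ofReal √(Real.pi / c) := by
  rw [lintegral_sub_left_eq_self (fun m => ENNReal.ofReal (Real.exp (-(c * m ^ 2)))) y]
  simp_rw [← neg_mul]
  rw [← ofReal_integral_eq_lintegral_ofReal (integrable_exp_neg_mul_sq hc)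
    (ae_of_all _ fun m => (Real.exp_pos _).le), integral_gaussian]

/-! ### The likelihood and the prior in regression coordinates -/

/-- The joint normal density is the marginal density of the first coordinate times the regression
density of the second one given the first. -/
lemma normalDensity_covMatrix {s σ ρ : ℝ} (hs : 0 < s) (hσ : 0 < σ)
    (hρ : ρ ∈ Set.Ioo (-1 : ℝ) 1) (m₁ m₂ : ℝ) (y : EuclideanSpace ℝ (Fin 2)) :
    normalDensity !₂[m₁, m₂] (covMatrix s σ ρ) y =
      (2 * Real.pi * (s * (σ * √(1 - ρ ^ 2))))⁻¹ *
        Real.exp (-(1 / 2) * ((y 0 - m₁) ^ 2 / s ^ 2 +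
          ((y 1 - m₂) - ρ * σ / s * (y 0 - m₁)) ^ 2 / (σ * √(1 - ρ ^ 2)) ^ 2)) := by
  have h1 := one_sub_sq_pos hρ
  have hdet : (covMatrix s σ ρ).det = (s * (σ * √(1 - ρ ^ 2))) ^ 2 := by
    rw [← genVar, genVar_eq, mul_pow, mul_pow, Real.sq_sqrt h1.le]
  rw [normalDensity, hdet, Real.sqrt_sq (by positivity)]
  congr 2
  rw [Matrix.inv_def, hdet, Ring.inverse_eq_inv', Matrix.adjugate_fin_two]
  simp only [covMatrix, dotProduct, Matrix.mulVec, Fin.sum_univ_two,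
    mul_pow, Real.sq_sqrt h1.le]
  simp
  field_simp
  ring

/-- The residual sum of squares of the regression line with slope `β`. -/
def residualSum (x : Data n) (β : ℝ) : ℝ :=
  scatter x 1 1 - 2 * β * scatter x 0 1 + β ^ 2 * scatter x 0 0

lemma sum_sq_sub (hn : n ≠ 0) (e : Fin n → ℝ) (c : ℝ) :
    ∑ k, (e k - c) ^ 2 = ∑ k, (e k - (∑ k, e k) / n) ^ 2 + n * ((∑ k, e k) / n - c) ^ 2 := by
  have hn' : (n : ℝ) ≠ 0 := by exact_mod_cast hn
  have h : ∀ c : ℝ, ∑ k, (e k - c) ^ 2 = ∑ k, e k ^ 2 - 2 * c * ∑ k, e k + n * c ^ 2 := by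
    intro c
    simp_rw [sub_sq, Finset.sum_add_distrib, Finset.sum_sub_distrib, ← Finset.sum_mul,
      ← Finset.mul_sum]
    simp
    ring
  rw [h, h]
  field_simp
  ring

lemma sum_sq_fst (hn : n ≠ 0) (x : Data n) (m₁ : ℝ) :
    ∑ k, (x k 0 - m₁) ^ 2 = scatter x 0 0 + n * (sampleMean x 0 - m₁) ^ 2 := by
  rw [sum_sq_sub hn (fun k => x k 0) m₁]
  simp only [scatter, sampleMean, Matrix.of_apply, sq]

lemma sum_sq_residual (hn : n ≠ 0) (x : Data n) (m₁ m₂ β : ℝ) :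
    ∑ k, ((x k 1 - m₂) - β * (x k 0 - m₁)) ^ 2 = residualSum x β +
      n * ((sampleMean x 1 - β * (sampleMean x 0 - m₁)) - m₂) ^ 2 := by
  have hmean : (∑ k, (x k 1 - β * x k 0)) / n = sampleMean x 1 - β * sampleMean x 0 := by
    rw [Finset.sum_sub_distrib, ← Finset.mul_sum, sampleMean, sampleMean]
    ring
  have h := sum_sq_sub hn (fun k => x k 1 - β * x k 0) (m₂ - β * m₁)
  rw [hmean] at h
  have h2 : ∑ k, ((x k 1 - β * x k 0) - (sampleMean x 1 - β * sampleMean x 0)) ^ 2 =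
      residualSum x β := by
    simp only [residualSum, scatter, Matrix.of_apply, Finset.mul_sum]
    rw [← Finset.sum_sub_distrib, ← Finset.sum_add_distrib]
    refine Finset.sum_congr rfl fun k _ => ?_
    ring
  rw [h2] at h
  convert h using 1
  · refine Finset.sum_congr rfl fun k _ => ?_
    ring
  · ring

lemma likelihood_eq (hn : n ≠ 0) (x : Data n) {s σ ρ : ℝ} (hs : 0 < s) (hσ : 0 < σ)
    (hρ : ρ ∈ Set.Ioo (-1 : ℝ) 1) (m₁ m₂ : ℝ) :
    likelihood x m₁ m₂ s σ ρ =
      ((2 * Real.pi * (s * (σ * √(1 - ρ ^ 2)))) ^ n)⁻¹ *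
        Real.exp (-(1 / 2) * ((scatter x 0 0 + n * (sampleMean x 0 - m₁) ^ 2) / s ^ 2 +
          (residualSum x (ρ * σ / s) + n * ((sampleMean x 1 - ρ * σ / s * (sampleMean x 0 - m₁))
            - m₂) ^ 2) / (σ * √(1 - ρ ^ 2)) ^ 2)) := by
  rw [← sum_sq_fst hn, ← sum_sq_residual hn, likelihood]
  simp_rw [normalDensity_covMatrix hs hσ hρ]
  rw [Finset.prod_mul_distrib, Finset.prod_const, Finset.card_univ, Fintype.card_fin, inv_pow,
    ← Real.exp_sum, ← Finset.mul_sum, Finset.sum_add_distrib, Finset.sum_div, Finset.sum_div]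

/-- Integrating the likelihood over the mean vector. -/
lemma lintegral_likelihood (hn : n ≠ 0) (x : Data n) {s σ ρ : ℝ} (hs : 0 < s) (hσ : 0 < σ)
    (hρ : ρ ∈ Set.Ioo (-1 : ℝ) 1) :
    ∫⁻ m₁, ∫⁻ m₂, ENNReal.ofReal (likelihood x m₁ m₂ s σ ρ) =
      ENNReal.ofReal (((2 * Real.pi) ^ n)⁻¹ * (2 * Real.pi / n) *
        (((s * (σ * √(1 - ρ ^ 2))) ^ (n - 1))⁻¹ *
        Real.exp (-(1 / 2) * (scatter x 0 0 / s ^ 2 +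
          residualSum x (ρ * σ / s) / (σ * √(1 - ρ ^ 2)) ^ 2)))) := by
  have hn' : (0 : ℝ) < n := by exact_mod_cast Nat.pos_of_ne_zero hn
  have h1 := one_sub_sq_pos hρ
  simp_rw [likelihood_eq hn x hs hσ hρ]
  set t := σ * √(1 - ρ ^ 2) with ht
  have htpos : 0 < t := by have := Real.sqrt_pos.2 h1; positivity
  set β := ρ * σ / s with hβ
  set R := residualSum x β with hR
  have inner : ∀ m₁ : ℝ, ∫⁻ m₂, ENNReal.ofReal (((2 * Real.pi * (s * t)) ^ n)⁻¹ *
      Real.exp (-(1 / 2) * ((scatter x 0 0 + n * (sampleMean x 0 - m₁) ^ 2) / s ^ 2 +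
        (R + n * ((sampleMean x 1 - β * (sampleMean x 0 - m₁)) - m₂) ^ 2) / t ^ 2))) =
      ENNReal.ofReal (((2 * Real.pi * (s * t)) ^ n)⁻¹ *
        Real.exp (-(1 / 2) * (scatter x 0 0 / s ^ 2 + R / t ^ 2)) * √(Real.pi / (n / (2 * t ^ 2))))
        * ENNReal.ofReal (Real.exp (-(n / (2 * s ^ 2) * (sampleMean x 0 - m₁) ^ 2))) := by
    intro m₁
    rw [ENNReal.ofReal_mul (q := √(Real.pi / (n / (2 * t ^ 2)))) (by positivity),
      mul_right_comm (ENNReal.ofReal _),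
      ← ENNReal.ofReal_mul (by positivity), ← lintegral_gaussian_sub (c := n / (2 * t ^ 2))
      (by positivity) (sampleMean x 1 - β * (sampleMean x 0 - m₁)),
      ← lintegral_const_mul _ (by fun_prop)]
    refine lintegral_congr fun m₂ => ?_
    rw [← ENNReal.ofReal_mul (by positivity), mul_assoc _ (Real.exp _), ← Real.exp_add,
      mul_assoc _ (Real.exp _), ← Real.exp_add]
    congr 3
    field_simp
    ring
  simp_rw [inner]
  rw [lintegral_const_mul _ (by fun_prop), lintegral_gaussian_sub (by positivity),
    ← ENNReal.ofReal_mul (by positivity)]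
  congr 1
  have e1 : √(Real.pi / (n / (2 * t ^ 2))) * √(Real.pi / (n / (2 * s ^ 2))) =
      (2 * Real.pi / n) * (s * t) := by
    rw [← Real.sqrt_mul (by positivity), show Real.pi / (n / (2 * t ^ 2)) *
      (Real.pi / (n / (2 * s ^ 2))) = ((2 * Real.pi / n) * (s * t)) ^ 2 by field_simp,
      Real.sqrt_sq (by positivity)]
  have e2 : (s * t) ^ n = (s * t) ^ (n - 1) * (s * t) := by
    rw [← pow_succ]; congr 1; omega
  rw [mul_assoc _ (√(Real.pi / (n / (2 * t ^ 2)))), e1, mul_pow, e2]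
  field_simp

/-- The first factor is the Jacobian of `(σ₂, ρ) ↦ (τ, β)`; the second one is the prior density in
the coordinates `(σ₁, τ, β)`. -/
lemma prior_eq {a b s σ ρ : ℝ} (hs : 0 < s) (hσ : 0 < σ) (hρ : ρ ∈ Set.Ioo (-1 : ℝ) 1) :
    prior a b s σ ρ = σ / (s * √(1 - ρ ^ 2)) *
      (s ^ (a - 2) * (σ * √(1 - ρ ^ 2)) ^ (b - 3)) := by
  have h1 := one_sub_sq_pos hρ
  set r := √(1 - ρ ^ 2) with hr
  have hrpos : 0 < r := Real.sqrt_pos.2 h1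
  have hrr : 1 - ρ ^ 2 = r ^ (2 : ℝ) := by rw [Real.rpow_two, Real.sq_sqrt h1.le]
  rw [prior, hrr, ← Real.rpow_mul hrpos.le, Real.mul_rpow hσ.le hrpos.le,
    show σ / (s * r) = σ ^ (1 : ℝ) * s ^ (-1 : ℝ) * r ^ (-1 : ℝ) by
      rw [Real.rpow_one, Real.rpow_neg_one, Real.rpow_neg_one]; field_simp,
    one_div, mul_inv, mul_inv, ← Real.rpow_neg hs.le, ← Real.rpow_neg hσ.le,
    ← Real.rpow_neg hrpos.le,
    show σ ^ (1 : ℝ) * s ^ (-1 : ℝ) * r ^ (-1 : ℝ) * (s ^ (a - 2) * (σ ^ (b - 3) * r ^ (b - 3))) =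
      (s ^ (-1 : ℝ) * s ^ (a - 2)) * (σ ^ (1 : ℝ) * σ ^ (b - 3)) * (r ^ (-1 : ℝ) * r ^ (b - 3))
      by ring,
    ← Real.rpow_add hs, ← Real.rpow_add hσ, ← Real.rpow_add hrpos]
  ring_nf

/-! ### The posterior distribution -/

lemma lintegral_prod_prod_swap {α β γ : Type*} [MeasurableSpace α] [MeasurableSpace β]
    [MeasurableSpace γ] {μ : Measure α} {ν : Measure β} {κ : Measure γ} [SFinite μ] [SFinite ν]
    [SFinite κ] {F : α × β × γ → ℝ≥0∞} (hF : Measurable F) :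
    ∫⁻ p, F p ∂(μ.prod (ν.prod κ)) = ∫⁻ q, ∫⁻ y, ∫⁻ z, F (y, z, q) ∂ν ∂μ ∂κ := by
  rw [lintegral_prod _ hF.aemeasurable]
  have h : ∀ y, ∫⁻ r, F (y, r) ∂(ν.prod κ) = ∫⁻ q, ∫⁻ z, F (y, z, q) ∂ν ∂κ := fun y =>
    lintegral_prod_symm _ (by fun_prop)
  simp_rw [h]
  refine lintegral_lintegral_swap (Measurable.aemeasurable ?_)
  exact Measurable.lintegral_prod_right' (f := fun w : (α × γ) × β => F (w.1.1, w.2, w.1.2))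
    (by fun_prop)

lemma volume_restrict_paramSpace :
    (volume : Measure (ℝ × ℝ × ℝ × ℝ × ℝ)).restrict paramSpace =
      (volume : Measure ℝ).prod ((volume : Measure ℝ).prod
        ((volume.restrict (Set.Ioi 0)).prod ((volume.restrict (Set.Ioi 0)).prod
          (volume.restrict (Set.Ioo (-1) 1))))) := by
  have h : paramSpace = Set.univ ×ˢ (Set.univ ×ˢ (Set.Ioi (0 : ℝ) ×ˢ (Set.Ioi (0 : ℝ) ×ˢ
      Set.Ioo (-1 : ℝ) 1))) := by
    ext p
    simp [paramSpace]
  rw [h, Measure.volume_eq_prod, ← Measure.prod_restrict, Measure.volume_eq_prod,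
    ← Measure.prod_restrict, Measure.volume_eq_prod, ← Measure.prod_restrict,
    Measure.volume_eq_prod, ← Measure.prod_restrict, Measure.restrict_univ]

lemma measurableSet_paramSpace : MeasurableSet paramSpace := by
  unfold paramSpace
  measurability

lemma ae_mem_paramRegion :
    ∀ᵐ q ∂((volume.restrict (Set.Ioi (0 : ℝ))).prod ((volume.restrict (Set.Ioi (0 : ℝ))).prod
      (volume.restrict (Set.Ioo (-1 : ℝ) 1)))),
      0 < q.1 ∧ 0 < q.2.1 ∧ q.2.2 ∈ Set.Ioo (-1 : ℝ) 1 := by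
  rw [Measure.prod_restrict, Measure.prod_restrict]
  exact ae_restrict_mem (measurableSet_Ioi.prod (measurableSet_Ioi.prod measurableSet_Ioo))

/-- Expectations of functions of `|Σ|` under the unnormalized posterior, with the mean vector
integrated out and in the coordinates `(σ₁, τ, β)`; here `|Σ| = σ₁ ^ 2 * τ ^ 2`. -/
lemma lintegral_unnormalizedPosterior (hn : n ≠ 0) (a b : ℝ) (x : Data n) {f : ℝ → ℝ≥0∞}
    (hf : Measurable f) :
    ∫⁻ p, f (genVar p.2.2.1 p.2.2.2.1 p.2.2.2.2) ∂(unnormalizedPosterior a b x) =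
      ∫⁻ s in Set.Ioi 0, ∫⁻ τ in Set.Ioi 0, ∫⁻ β, f (s ^ 2 * τ ^ 2) * ENNReal.ofReal
        (s ^ (a - 2) * τ ^ (b - 3) * (((2 * Real.pi) ^ n)⁻¹ * (2 * Real.pi / n) *
          (((s * τ) ^ (n - 1))⁻¹ * Real.exp (-(1 / 2) * (scatter x 0 0 / s ^ 2 +
            residualSum x β / τ ^ 2))))) := by
  -- On the parameter space the likelihood has an explicit, visibly measurable form.
  set L : ℝ × ℝ × ℝ × ℝ × ℝ → ℝ := fun p =>
    ((2 * Real.pi * (p.2.2.1 * (p.2.2.2.1 * √(1 - p.2.2.2.2 ^ 2)))) ^ n)⁻¹ *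
      Real.exp (-(1 / 2) * ((scatter x 0 0 + n * (sampleMean x 0 - p.1) ^ 2) / p.2.2.1 ^ 2 +
        (residualSum x (p.2.2.2.2 * p.2.2.2.1 / p.2.2.1) +
          n * ((sampleMean x 1 - p.2.2.2.2 * p.2.2.2.1 / p.2.2.1 * (sampleMean x 0 - p.1))
            - p.2.1) ^ 2) / (p.2.2.2.1 * √(1 - p.2.2.2.2 ^ 2)) ^ 2)) with hL
  have hLm : Measurable L := by simp only [hL, residualSum]; fun_prop
  have hpm : Measurable fun q : ℝ × ℝ × ℝ => prior a b q.1 q.2.1 q.2.2 := by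
    unfold prior; fun_prop
  have hgm : Measurable fun q : ℝ × ℝ × ℝ => genVar q.1 q.2.1 q.2.2 := by
    simp only [genVar_eq]; fun_prop
  have hdens : unnormalizedPosterior a b x = (volume.restrict paramSpace).withDensity fun p =>
      ENNReal.ofReal (prior a b p.2.2.1 p.2.2.2.1 p.2.2.2.2 * L p) := by
    refine withDensity_congr_ae ?_
    filter_upwards [ae_restrict_mem measurableSet_paramSpace] with p hp
    rw [likelihood_eq hn x hp.1 hp.2.1 hp.2.2]
  have hdm : Measurable fun p : ℝ × ℝ × ℝ × ℝ × ℝ =>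
      ENNReal.ofReal (prior a b p.2.2.1 p.2.2.2.1 p.2.2.2.2 * L p) :=
    ((hpm.comp (measurable_snd.comp measurable_snd)).mul hLm).ennreal_ofReal
  have hfm : Measurable fun p : ℝ × ℝ × ℝ × ℝ × ℝ => f (genVar p.2.2.1 p.2.2.2.1 p.2.2.2.2) :=
    hf.comp (hgm.comp (measurable_snd.comp measurable_snd))
  rw [hdens, lintegral_withDensity_eq_lintegral_mul _ hdm hfm, volume_restrict_paramSpace,
    lintegral_prod_prod_swap (hdm.mul hfm)]
  set G : ℝ → ℝ × ℝ → ℝ≥0∞ := fun s u => f (s ^ 2 * u.1 ^ 2) * ENNReal.ofReal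
        (s ^ (a - 2) * u.1 ^ (b - 3) * (((2 * Real.pi) ^ n)⁻¹ * (2 * Real.pi / n) *
          (((s * u.1) ^ (n - 1))⁻¹ * Real.exp (-(1 / 2) * (scatter x 0 0 / s ^ 2 +
            residualSum x u.2 / u.1 ^ 2))))) with hG
  have hGm : Measurable fun w : ℝ × ℝ × ℝ => G w.1 w.2 := by
    simp only [hG, residualSum]; fun_prop
  -- Integrating out the means leaves the Jacobian factor times a function of `(σ₁, τ, β)`.
  have hmarg : ∀ s σ ρ : ℝ, 0 < s → 0 < σ → ρ ∈ Set.Ioo (-1 : ℝ) 1 →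
      ∫⁻ m₁, ∫⁻ m₂, ENNReal.ofReal (prior a b s σ ρ * L (m₁, m₂, s, σ, ρ)) * f (genVar s σ ρ) =
      ENNReal.ofReal (σ / (s * √(1 - ρ ^ 2))) * G s (σ * √(1 - ρ ^ 2), ρ * σ / s) := by
    intro s σ ρ hs hσ hρ
    have h1 := one_sub_sq_pos hρ
    have hr := Real.sqrt_pos.2 h1
    have hp : 0 ≤ prior a b s σ ρ := by rw [prior_eq hs hσ hρ]; positivity
    have hlik : ∀ m₁ m₂, L (m₁, m₂, s, σ, ρ) = likelihood x m₁ m₂ s σ ρ := fun m₁ m₂ =>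
      (likelihood_eq hn x hs hσ hρ m₁ m₂).symm
    have hint : ∀ m₁, ∫⁻ m₂, ENNReal.ofReal (prior a b s σ ρ * L (m₁, m₂, s, σ, ρ)) *
        f (genVar s σ ρ) = ENNReal.ofReal (prior a b s σ ρ) *
          (∫⁻ m₂, ENNReal.ofReal (L (m₁, m₂, s, σ, ρ))) * f (genVar s σ ρ) := by
      intro m₁
      rw [lintegral_mul_const _ (by fun_prop)]
      simp_rw [ENNReal.ofReal_mul hp]
      rw [lintegral_const_mul _ (by fun_prop)]
    have hm : Measurable fun m₁ => ∫⁻ m₂, ENNReal.ofReal (L (m₁, m₂, s, σ, ρ)) :=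
      Measurable.lintegral_prod_right' (f := fun w : ℝ × ℝ => ENNReal.ofReal (L (w.1, w.2, s, σ, ρ)))
        (by fun_prop)
    simp_rw [hint]
    rw [lintegral_mul_const _ (by fun_prop), lintegral_const_mul _ hm]
    simp_rw [hlik]
    rw [lintegral_likelihood hn x hs hσ hρ, prior_eq hs hσ hρ, genVar_eq,
      ENNReal.ofReal_mul (by positivity), hG]
    simp only
    rw [ENNReal.ofReal_mul (p := s ^ (a - 2) * (σ * √(1 - ρ ^ 2)) ^ (b - 3)) (by positivity),
      mul_pow σ, Real.sq_sqrt h1.le]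
    ring
  have hstep : ∀ᵐ q ∂((volume.restrict (Set.Ioi (0 : ℝ))).prod
      ((volume.restrict (Set.Ioi (0 : ℝ))).prod (volume.restrict (Set.Ioo (-1 : ℝ) 1)))),
      (∫⁻ m₁, ∫⁻ m₂, ENNReal.ofReal (prior a b q.1 q.2.1 q.2.2 * L (m₁, m₂, q)) *
        f (genVar q.1 q.2.1 q.2.2)) = ENNReal.ofReal (q.2.1 / (q.1 * √(1 - q.2.2 ^ 2))) *
          G q.1 (q.2.1 * √(1 - q.2.2 ^ 2), q.2.2 * q.2.1 / q.1) := by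
    filter_upwards [ae_mem_paramRegion] with q hq
    exact hmarg q.1 q.2.1 q.2.2 hq.1 hq.2.1 hq.2.2
  have hHm : Measurable fun q : ℝ × ℝ × ℝ =>
      ENNReal.ofReal (q.2.1 / (q.1 * √(1 - q.2.2 ^ 2))) *
          G q.1 (q.2.1 * √(1 - q.2.2 ^ 2), q.2.2 * q.2.1 / q.1) :=
    Measurable.mul (by fun_prop) (hGm.comp
      (f := fun w : ℝ × ℝ × ℝ => (w.1, (w.2.1 * √(1 - w.2.2 ^ 2), w.2.2 * w.2.1 / w.1)))
      (by fun_prop))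
  refine (lintegral_congr_ae hstep).trans ?_
  rw [lintegral_prod _ hHm.aemeasurable]
  refine setLIntegral_congr_fun measurableSet_Ioi fun s (hs : 0 < s) => ?_
  simp only
  refine (lintegral_prod _ (hHm.comp measurable_prodMk_left).aemeasurable).trans ?_
  exact lintegral_regression hs (hGm.comp measurable_prodMk_left)

lemma scatter_symm (x : Data n) : scatter x 1 0 = scatter x 0 1 := by
  simp only [scatter, Matrix.of_apply, mul_comm]

lemma scatter_zero_zero_pos {x : Data n} (hx : 0 < (scatter x).det) : 0 < scatter x 0 0 := by
  have h0 : 0 ≤ scatter x 0 0 := by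
    simp only [scatter, Matrix.of_apply]
    exact Finset.sum_nonneg fun k _ => mul_self_nonneg _
  refine lt_of_le_of_ne h0 fun h => ?_
  rw [Matrix.det_fin_two, ← h, scatter_symm] at hx
  nlinarith [sq_nonneg (scatter x 0 1)]

/-- The residual sum of squares is quadratic in the slope, with minimum `|S| / S₁₁`. -/
lemma lintegral_slope {x : Data n} (hx : 0 < scatter x 0 0) {τ : ℝ} (hτ : 0 < τ) :
    ∫⁻ β, ENNReal.ofReal (Real.exp (-(residualSum x β / (2 * τ ^ 2)))) =
      ENNReal.ofReal (√(2 * Real.pi / scatter x 0 0) * (τ *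
        Real.exp (-((scatter x).det / scatter x 0 0 / (2 * τ ^ 2))))) := by
  have h : ∀ β, Real.exp (-(residualSum x β / (2 * τ ^ 2))) =
      Real.exp (-((scatter x).det / scatter x 0 0 / (2 * τ ^ 2))) *
        Real.exp (-(scatter x 0 0 / (2 * τ ^ 2) * (scatter x 0 1 / scatter x 0 0 - β) ^ 2)) := by
    intro β
    rw [← Real.exp_add, Matrix.det_fin_two, scatter_symm, residualSum]
    congr 1
    field_simp
    ring
  simp_rw [h, ENNReal.ofReal_mul (Real.exp_pos _).le]
  rw [lintegral_const_mul _ (by fun_prop), lintegral_gaussian_sub (by positivity),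
    ← ENNReal.ofReal_mul (by positivity)]
  have : √(Real.pi / (scatter x 0 0 / (2 * τ ^ 2))) = √(2 * Real.pi / scatter x 0 0) * τ := by
    rw [show Real.pi / (scatter x 0 0 / (2 * τ ^ 2)) = (2 * Real.pi / scatter x 0 0) * τ ^ 2 by
      field_simp, Real.sqrt_mul' _ (by positivity), Real.sqrt_sq hτ.le]
  rw [this]
  congr 1
  ring

/-- Up to a positive constant, integrating a function of `|Σ|` against prior times likelihood is
integrating it against the law of `|S|` over a product of independent chi-squared variables: one of
them comes from `σ₁ ^ 2`, the other from the residual variance `τ ^ 2`. -/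
lemma exists_lintegral_genVar (hn : n ≠ 0) {a b : ℝ} (ha : a < n) (hb : b < n) {x : Data n}
    (hx : 0 < (scatter x).det) :
    ∃ C : ℝ, 0 < C ∧ ∀ f : ℝ → ℝ≥0∞, Measurable f →
      ∫⁻ p, f (genVar p.2.2.1 p.2.2.2.1 p.2.2.2.2) ∂(unnormalizedPosterior a b x) =
        ENNReal.ofReal C * ∫⁻ w, f ((scatter x).det / w) ∂(chiSquaredMul (n - a) (n - b)) := by
  have hn' : (0 : ℝ) < n := by exact_mod_cast Nat.pos_of_ne_zero hn
  have hka : 0 < (n : ℝ) - a := by linarith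
  have hkb : 0 < (n : ℝ) - b := by linarith
  have hA := scatter_zero_zero_pos hx
  set A := scatter x 0 0 with hAdef
  have hB : 0 < (scatter x).det / A := by positivity
  set B := (scatter x).det / A with hBdef
  have hAB : A * B = (scatter x).det := by rw [hBdef]; field_simp
  obtain ⟨C₁, hC₁, h₁⟩ := exists_lintegral_eq_chiSquared hka hA
  obtain ⟨C₂, hC₂, h₂⟩ := exists_lintegral_eq_chiSquared hkb hB
  set c : ℝ := ((2 * Real.pi) ^ n)⁻¹ * (2 * Real.pi / n) * √(2 * Real.pi / A) with hc
  have hcpos : 0 < c := by positivity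
  have := isProbabilityMeasure_chiSquared hkb
  refine ⟨c * C₁ * C₂, by positivity, fun f hf => ?_⟩
  rw [lintegral_unnormalizedPosterior hn a b x hf]
  have hinner : ∀ s τ : ℝ, 0 < s → 0 < τ → ∫⁻ β, f (s ^ 2 * τ ^ 2) * ENNReal.ofReal
        (s ^ (a - 2) * τ ^ (b - 3) * (((2 * Real.pi) ^ n)⁻¹ * (2 * Real.pi / n) *
          (((s * τ) ^ (n - 1))⁻¹ * Real.exp (-(1 / 2) * (A / s ^ 2 +
            residualSum x β / τ ^ 2))))) =
      ENNReal.ofReal c * ENNReal.ofReal (s ^ (-(n - a) - 1) * Real.exp (-(A / (2 * s ^ 2)))) *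
        (f (s ^ 2 * τ ^ 2) *
          ENNReal.ofReal (τ ^ (-(n - b) - 1) * Real.exp (-(B / (2 * τ ^ 2))))) := by
    intro s τ hs hτ
    have hsplit : ∀ β, s ^ (a - 2) * τ ^ (b - 3) * (((2 * Real.pi) ^ n)⁻¹ * (2 * Real.pi / n) *
          (((s * τ) ^ (n - 1))⁻¹ * Real.exp (-(1 / 2) * (A / s ^ 2 + residualSum x β / τ ^ 2)))) =
        (s ^ (a - 2) * τ ^ (b - 3) * (((2 * Real.pi) ^ n)⁻¹ * (2 * Real.pi / n) *
          (((s * τ) ^ (n - 1))⁻¹ * Real.exp (-(A / (2 * s ^ 2)))))) *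
          Real.exp (-(residualSum x β / (2 * τ ^ 2))) := by
      intro β
      rw [show -(1 / 2) * (A / s ^ 2 + residualSum x β / τ ^ 2) =
        -(A / (2 * s ^ 2)) + -(residualSum x β / (2 * τ ^ 2)) by field_simp; ring, Real.exp_add]
      ring
    have hRm : Measurable fun β => residualSum x β := by unfold residualSum; fun_prop
    simp_rw [hsplit, ENNReal.ofReal_mul (show 0 ≤ s ^ (a - 2) * τ ^ (b - 3) *
      (((2 * Real.pi) ^ n)⁻¹ * (2 * Real.pi / n) *
          (((s * τ) ^ (n - 1))⁻¹ * Real.exp (-(A / (2 * s ^ 2))))) by positivity)]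
    rw [lintegral_const_mul _ (by fun_prop), lintegral_const_mul _ (by fun_prop),
      lintegral_slope hA hτ, ← hAdef, ← hBdef, ← ENNReal.ofReal_mul (by positivity),
      mul_left_comm _ (f _), ← ENNReal.ofReal_mul hcpos.le, ← ENNReal.ofReal_mul (by positivity)]
    congr 2
    have es : s ^ (-(n - a) - 1) = s ^ (a - 2) * (s ^ (n - 1))⁻¹ := by
      rw [← Real.rpow_natCast, ← Real.rpow_neg hs.le, ← Real.rpow_add hs,
        Nat.cast_sub (Nat.one_le_iff_ne_zero.2 hn)]
      congr 1; push_cast; ring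
    have et : τ ^ (-(n - b) - 1) = τ ^ (b - 3) * (τ ^ (n - 1))⁻¹ * τ := by
      nth_rewrite 4 [← Real.rpow_one τ]
      rw [← Real.rpow_natCast, ← Real.rpow_neg hτ.le, ← Real.rpow_add hτ, ← Real.rpow_add hτ,
        Nat.cast_sub (Nat.one_le_iff_ne_zero.2 hn)]
      congr 1; push_cast; ring
    rw [es, et, hc, mul_pow, mul_inv]
    ring
  calc _ = ∫⁻ s in Set.Ioi 0, ENNReal.ofReal c * ENNReal.ofReal C₂ *
        ((∫⁻ z, f (s ^ 2 * (B / z)) ∂(chiSquared (n - b))) *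
          ENNReal.ofReal (s ^ (-(n - a) - 1) * Real.exp (-(A / (2 * s ^ 2))))) := by
        refine setLIntegral_congr_fun measurableSet_Ioi fun s (hs : 0 < s) => ?_
        have : ∀ τ ∈ Set.Ioi (0 : ℝ), _ = _ := fun τ hτ => hinner s τ hs hτ
        rw [setLIntegral_congr_fun measurableSet_Ioi this, lintegral_const_mul _ (by fun_prop),
          h₂ (fun y => f (s ^ 2 * y)) (by fun_prop)]
        ring
    _ = ENNReal.ofReal c * ENNReal.ofReal C₂ * (ENNReal.ofReal C₁ *
        ∫⁻ z₁, ∫⁻ z₂, f (A / z₁ * (B / z₂)) ∂(chiSquared (n - b)) ∂(chiSquared (n - a))) := by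
        have hm : Measurable fun y : ℝ => ∫⁻ z, f (y * (B / z)) ∂(chiSquared ((n : ℝ) - b)) :=
          Measurable.lintegral_prod_right' (f := fun p : ℝ × ℝ => f (p.1 * (B / p.2)))
            (by fun_prop)
        have hm' : Measurable fun s : ℝ => (∫⁻ z, f (s ^ 2 * (B / z)) ∂(chiSquared ((n : ℝ) - b))) *
            ENNReal.ofReal (s ^ (-(n - a) - 1) * Real.exp (-(A / (2 * s ^ 2)))) :=
          (hm.comp (f := fun s : ℝ => s ^ 2) (by fun_prop)).mul (by fun_prop)
        rw [lintegral_const_mul _ hm',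
          h₁ (fun y => ∫⁻ z, f (y * (B / z)) ∂(chiSquared ((n : ℝ) - b))) hm]
    _ = _ := by
        rw [lintegral_chiSquaredMul hka hkb (by fun_prop),
          ENNReal.ofReal_mul (p := c * C₁) (by positivity), ENNReal.ofReal_mul (p := c) hcpos.le]
        simp_rw [div_mul_div_comm, hAB]
        ring

lemma unnormalizedPosterior_univ_of_lintegral {a b C : ℝ} {x : Data n} {ν : Measure ℝ}
    [IsProbabilityMeasure ν]
    (h : ∀ f : ℝ → ℝ≥0∞, Measurable f →
      ∫⁻ p, f (genVar p.2.2.1 p.2.2.2.1 p.2.2.2.2) ∂(unnormalizedPosterior a b x) =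
        ENNReal.ofReal C * ∫⁻ w, f ((scatter x).det / w) ∂ν) :
    unnormalizedPosterior a b x Set.univ = ENNReal.ofReal C := by
  simpa using h (fun _ => 1) measurable_const

/-- The posterior is proper, and under it `|Σ|` is distributed as `|S|` over a product of
independent chi-squared variables. -/
lemma posterior_proper_and_genVar (hn : n ≠ 0) {a b : ℝ} (ha : a < n) (hb : b < n) {x : Data n}
    (hx : 0 < (scatter x).det) :
    IsProbabilityMeasure (posterior a b x) ∧ posteriorGenVar a b x =
      (chiSquaredMul (n - a) (n - b)).map fun w => (scatter x).det / w := by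
  have := isProbabilityMeasure_chiSquaredMul (k := n - a) (l := n - b) (by linarith) (by linarith)
  obtain ⟨C, hC, h⟩ := exists_lintegral_genVar hn ha hb hx
  have huniv := unnormalizedPosterior_univ_of_lintegral h
  have hC0 : ENNReal.ofReal C ≠ 0 := by simpa using hC
  refine ⟨⟨?_⟩, ?_⟩
  · rw [posterior, Measure.smul_apply, huniv, smul_eq_mul,
      ENNReal.inv_mul_cancel hC0 ENNReal.ofReal_ne_top]
  · refine Measure.ext_of_lintegral _ fun f hf => ?_
    have hgm : Measurable fun p : ℝ × ℝ × ℝ × ℝ × ℝ => genVar p.2.2.1 p.2.2.2.1 p.2.2.2.2 := by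
      simp only [genVar_eq]; fun_prop
    rw [posteriorGenVar, lintegral_map hf hgm, posterior, lintegral_smul_measure, h f hf, huniv,
      smul_eq_mul, ← mul_assoc, ENNReal.inv_mul_cancel hC0 ENNReal.ofReal_ne_top, one_mul,
      lintegral_map hf (by fun_prop)]

/-! ### Frequentist coverage -/

/-- The coverage event is, almost surely, that `|S| / |Σ|` exceeds the lower quantile of the product
law; data sets with `|S| = 0`, where the posterior is meaningless, form a null set. -/
lemma coverage_eq (hn : 3 ≤ n) {a b : ℝ} (ha : a < n) (hb : b < n) (μ₁ μ₂ : ℝ) {σ₁ σ₂ ρ : ℝ}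
    (h₁ : 0 < σ₁) (h₂ : 0 < σ₂) (hρ : ρ ∈ Set.Ioo (-1 : ℝ) 1) {α : ℝ}
    (hα : α ∈ Set.Ioo (0 : ℝ) 1) :
    coverage n a b α μ₁ μ₂ σ₁ σ₂ ρ = (chiSquaredMul (n - 1) (n - 2)).real
      (Set.Ioi (quantile (chiSquaredMul (n - a) (n - b)) α)) := by
  have hn' : (3 : ℝ) ≤ n := by exact_mod_cast hn
  have hka : 0 < (n : ℝ) - a := by linarith
  have hkb : 0 < (n : ℝ) - b := by linarith
  have hθ := genVar_pos h₁ h₂ hρ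
  have := isProbabilityMeasure_chiSquaredMul hka hkb
  have := nullSingletonClass_chiSquaredMul hka hkb
  have hpos := ae_pos_chiSquaredMul hka hkb
  have hIoo := fun s t => chiSquaredMul_pos_of_Ioo (s := s) (t := t) hka hkb
  have hq := (exists_quantile hpos hIoo hα).1
  have hm : Measurable fun x : Data n => (scatter x).det / genVar σ₁ σ₂ ρ :=
    measurable_det_scatter.div_const _
  have hlaw := map_det_scatter_div_samplingLaw hn μ₁ μ₂ h₁ h₂ hρ
  have hdet : ∀ᵐ x ∂(samplingLaw n μ₁ μ₂ σ₁ σ₂ ρ), 0 < (scatter x).det / genVar σ₁ σ₂ ρ := by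
    refine ae_of_ae_map hm.aemeasurable ?_
    rw [hlaw]
    exact ae_pos_chiSquaredMul (by linarith) (by linarith)
  rw [← hlaw, map_measureReal_apply hm measurableSet_Ioi, coverage]
  refine measureReal_congr ?_
  filter_upwards [hdet] with x hx
  have hD : 0 < (scatter x).det := (div_pos_iff_of_pos_right hθ).1 hx
  refine propext ?_
  change genVar σ₁ σ₂ ρ < quantile (posteriorGenVar a b x) (1 - α) ↔
    quantile (chiSquaredMul (n - a) (n - b)) α < (scatter x).det / genVar σ₁ σ₂ ρ
  rw [(posterior_proper_and_genVar (by omega) ha hb hD).2, quantile_map_div hpos hIoo hα hD,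
    lt_div_iff₀ hq, lt_div_iff₀ hθ, mul_comm]

/-- Two laws that are continuous and charge every interval of the positive half-line are equal as
soon as each quantile of the second one has the matching upper tail probability under the first
one, because every positive number is a quantile. -/
lemma forall_tail_quantile_iff {ν ν' : Measure ℝ} [IsProbabilityMeasure ν]
    [IsProbabilityMeasure ν'] [NullSingletonClass ν'] (hν : ∀ᵐ w ∂ν, 0 < w)
    (hpos : ∀ᵐ w ∂ν', 0 < w) (hIoo : ∀ s t, 0 ≤ s → s < t → ν' (Set.Ioo s t) ≠ 0) :
    (∀ α ∈ Set.Ioo (0 : ℝ) 1, ν.real (Set.Ioi (quantile ν' α)) = 1 - α) ↔ ν = ν' := by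
  have htail : ∀ t, ν.real (Set.Ioi t) = 1 - ν.real (Set.Iic t) := fun t => by
    rw [← Set.compl_Iic, probReal_compl_eq_one_sub measurableSet_Iic]
  have hquant : ∀ α ∈ Set.Ioo (0 : ℝ) 1, ν'.real (Set.Iic (quantile ν' α)) = α := by
    intro α hα
    obtain ⟨hq, h⟩ := exists_quantile hpos hIoo hα
    exact le_antisymm ((h _ hq).2.2 le_rfl) ((h _ hq).1.2 le_rfl)
  constructor
  · intro h
    refine Measure.eq_of_cdf ν ν' ?_
    ext t
    rw [cdf_eq_real, cdf_eq_real]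
    rcases le_or_gt t 0 with ht | ht
    · have : ∀ {κ : Measure ℝ}, (∀ᵐ w ∂κ, 0 < w) → κ.real (Set.Iic t) = 0 := by
        intro κ hκ
        rw [measureReal_def, measure_mono_null ?_ (ae_iff.1 hκ), ENNReal.toReal_zero]
        exact fun w hw => not_lt.2 (le_trans hw ht)
      rw [this hν, this hpos]
    · have h0 : 0 < ν'.real (Set.Iic t) := by
        rw [measureReal_def, ENNReal.toReal_pos_iff]
        exact ⟨lt_of_lt_of_le (pos_iff_ne_zero.2 (hIoo 0 t le_rfl ht))
          (measure_mono fun w hw => hw.2.le), measure_lt_top _ _⟩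
      have h1 : ν'.real (Set.Iic t) < 1 := by
        have h2 : 0 < ν'.real (Set.Ioi t) := by
          rw [measureReal_def, ENNReal.toReal_pos_iff]
          exact ⟨lt_of_lt_of_le (pos_iff_ne_zero.2 (hIoo t (t + 1) ht.le (by linarith)))
            (measure_mono fun w hw => hw.1), measure_lt_top _ _⟩
        rw [← Set.compl_Iic, probReal_compl_eq_one_sub measurableSet_Iic] at h2
        linarith
      have hα : ν'.real (Set.Iic t) ∈ Set.Ioo (0 : ℝ) 1 := ⟨h0, h1⟩
      obtain ⟨-, hq⟩ := exists_quantile hpos hIoo hα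
      have hqt : quantile ν' (ν'.real (Set.Iic t)) = t :=
        le_antisymm ((hq t ht).1.1 le_rfl) ((hq t ht).2.1 le_rfl)
      have := h _ hα
      rw [hqt, htail] at this
      linarith
  · rintro rfl α hα
    rw [htail, hquant α hα]

end BivariateNormal

end

theorem theorem6 (n : ℕ) (hn : 3 ≤ n) (a b : ℝ) (ha : a < n) (hb : b < n) :
    (∀ x : BivariateNormal.Data n, 0 < (BivariateNormal.scatter x).det →
      IsProbabilityMeasure (BivariateNormal.posterior a b x) ∧
      BivariateNormal.posteriorGenVar a b x =
        (BivariateNormal.chiSquaredPair (n - a) (n - b)).map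
          (fun z => (BivariateNormal.scatter x).det / (z.1 * z.2))) ∧
    (∀ μ₁ μ₂ σ₁ σ₂ ρ : ℝ, 0 < σ₁ → 0 < σ₂ → ρ ∈ Set.Ioo (-1 : ℝ) 1 →
      (∀ α ∈ Set.Ioo (0 : ℝ) 1,
        BivariateNormal.coverage n a b α μ₁ μ₂ σ₁ σ₂ ρ =
          (BivariateNormal.chiSquaredPair (n - 1) (n - 2)).real
            {z | BivariateNormal.quantile
              ((BivariateNormal.chiSquaredPair (n - a) (n - b)).map (fun w => w.1 * w.2)) α
                < z.1 * z.2}) ∧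
      ((∀ α ∈ Set.Ioo (0 : ℝ) 1,
        BivariateNormal.coverage n a b α μ₁ μ₂ σ₁ σ₂ ρ = 1 - α) ↔
          (a = 1 ∧ b = 2) ∨ (a = 2 ∧ b = 1))) := by
  open BivariateNormal in
  have hn' : (3 : ℝ) ≤ n := by exact_mod_cast hn
  have hka : 0 < (n : ℝ) - a := by linarith
  have hkb : 0 < (n : ℝ) - b := by linarith
  have hk₁ : 0 < (n : ℝ) - 1 := by linarith
  have hk₂ : 0 < (n : ℝ) - 2 := by linarith
  refine ⟨fun x hx => ?_, fun μ₁ μ₂ σ₁ σ₂ ρ h₁ h₂ hρ => ⟨fun α hα => ?_, ?_⟩⟩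
  · obtain ⟨hp, hg⟩ := posterior_proper_and_genVar (by omega) ha hb hx
    refine ⟨hp, ?_⟩
    rw [hg, chiSquaredMul, Measure.map_map (by fun_prop) (by fun_prop)]
    rfl
  · rw [coverage_eq hn ha hb μ₁ μ₂ h₁ h₂ hρ hα, chiSquaredMul,
      map_measureReal_apply (by fun_prop) measurableSet_Ioi]
    rfl
  · have := isProbabilityMeasure_chiSquaredMul hk₁ hk₂
    have := isProbabilityMeasure_chiSquaredMul hka hkb
    have := nullSingletonClass_chiSquaredMul hka hkb
    have hiff := forall_tail_quantile_iff (ae_pos_chiSquaredMul hk₁ hk₂)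
      (ae_pos_chiSquaredMul hka hkb) fun s t => chiSquaredMul_pos_of_Ioo (s := s) (t := t) hka hkb
    have hcov : (∀ α ∈ Set.Ioo (0 : ℝ) 1, coverage n a b α μ₁ μ₂ σ₁ σ₂ ρ = 1 - α) ↔
        chiSquaredMul (n - 1) (n - 2) = chiSquaredMul (n - a) (n - b) := by
      rw [← hiff]
      exact forall₂_congr fun α hα => by rw [coverage_eq hn ha hb μ₁ μ₂ h₁ h₂ hρ hα]
    rw [hcov]
    constructor
    · intro h
      rcases eq_or_eq_of_chiSquaredMul_eq hk₁ hk₂ hka hkb h with ⟨e₁, e₂⟩ | ⟨e₁, e₂⟩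
      · exact Or.inl ⟨by linarith, by linarith⟩
      · exact Or.inr ⟨by linarith, by linarith⟩
    · rintro (⟨rfl, rfl⟩ | ⟨rfl, rfl⟩)
      · rfl
      · exact chiSquaredMul_comm hk₁ hk₂
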